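/- Let $m\ge 1$ be an integer, let $\Delta\subset\mathbb R^2$ be the closed triangle with vertices $(0,0)$, $(m,0)$, $(0,m)$, and let $\tau$ be a triangulation of $\Delta$ all of whose vertices have integer coordinates. Suppose that $\tau$ is convex, i.e. that there is a convex piecewise linear function $\nu:\Delta\to\mathbb R_{\ge 0}$ which is (affine-)linear on each triangle of $\tau$ and is not linear on the union of any two distinct triangles of $\tau$; fix such a $\nu$. Let every vertex $(k,l)$ of $\tau$ be equipped with a sign $\sigma_{k,l}\in\{+1,-1\}$. In every triangle of $\tau$ whose vertices do not all have the same sign, draw the midline separating the vertices with sign $+$ from those with sign $-$ (the closed segment joining the midpoints of the two sides whose endpoints have opposite signs), and let $L\subset\Delta$ be the union of these midlines. For $t>0$ put $$b_t(x,y)=\sum_{(k,l)\text{ a vertex of }\tau}\sigma_{k,l}\,t^{\nu(k,l)}x^ky^l .$$ Then for all sufficiently small $t>0$ the curve $a_t=\{(x,y)\in\mathbb R^2_{++}: b_t(x,y)=0\}$ in the open first quadrant $\mathbb R^2_{++}=\{(x,y)\in\mathbb R^2: x>0,\ y>0\}$ is such that the pair $(\mathbb R^2_{++},a_t)$ is homeomorphic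 to the pair $(\operatorname{Int}\Delta,\ L\cap\operatorname{Int}\Delta)$, that is, there is a homeomorphism $\mathbb R^2_{++}\to\operatorname{Int}\Delta$ mapping $a_t$ onto $L\cap\operatorname{Int}\Delta$. -/

import Mathlib

open Filter Topology

noncomputable section

namespace Patchwork

/-- The closed triangle `Δ` with vertices `(0,0)`, `(m,0)`, `(0,m)`. -/
def bigTriangle (m : ℕ) : Set (ℝ × ℝ) :=
  convexHull ℝ {((0 : ℝ), (0 : ℝ)), ((m : ℝ), (0 : ℝ)), ((0 : ℝ), (m : ℝ))}

/-- `τ` is a triangulation of `Δ` whose vertices have integer coordinates. Such a `τ` is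
automatically finite, and every simplex of it is a face of a triangle of it. -/
structure IsLatticeTriangulation (m : ℕ) (τ : Geometry.SimplicialComplex ℝ (ℝ × ℝ)) : Prop where
  space_eq : τ.space = bigTriangle m
  integral : ∀ v ∈ τ.vertices, ∃ k l : ℤ, v = ((k : ℝ), (l : ℝ))

/-- The triangles of `τ`, each given by its set of three vertices. -/
def triangles (τ : Geometry.SimplicialComplex ℝ (ℝ × ℝ)) : Set (Finset (ℝ × ℝ)) :=
  {s | s ∈ τ.faces ∧ s.card = 3}

/-- `ν` coincides on `S` with a polynomial of degree at most one. -/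
def IsLinearOn (ν : ℝ × ℝ → ℝ) (S : Set (ℝ × ℝ)) : Prop :=
  ∃ f : (ℝ × ℝ) →ᵃ[ℝ] ℝ, Set.EqOn ν f S

/-- `ν` certifies that the triangulation `τ` of `Δ` is convex: it is a nonnegative convex function
on `Δ`, linear on each triangle of `τ` and not linear on the union of any two of them. Only the
values of `ν` on `Δ` matter. -/
structure CertifiesConvexity (m : ℕ) (τ : Geometry.SimplicialComplex ℝ (ℝ × ℝ))
    (ν : ℝ × ℝ → ℝ) : Prop where
  nonneg : ∀ p ∈ bigTriangle m, 0 ≤ ν p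
  convexOn : ConvexOn ℝ (bigTriangle m) ν
  linear : ∀ s ∈ triangles τ, IsLinearOn ν (convexHull ℝ (s : Set (ℝ × ℝ)))
  not_linear : ∀ s ∈ triangles τ, ∀ s' ∈ triangles τ, s ≠ s' →
    ¬ IsLinearOn ν (convexHull ℝ (s : Set (ℝ × ℝ)) ∪ convexHull ℝ (s' : Set (ℝ × ℝ)))

/-- The point of the plane with coordinates `(k, l)`. Lattice points of `Δ` have nonnegative
coordinates, so they are all of this form. -/
def latticePoint (p : ℕ × ℕ) : ℝ × ℝ := ((p.1 : ℝ), (p.2 : ℝ))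

open Classical in
/-- The pairs `(k, l)` that are vertices of `τ`, for a triangulation `τ` of `Δ`. -/
def vertexFinset (m : ℕ) (τ : Geometry.SimplicialComplex ℝ (ℝ × ℝ)) : Finset (ℕ × ℕ) :=
  {p ∈ Finset.range (m + 1) ×ˢ Finset.range (m + 1) | latticePoint p ∈ τ.vertices}

open Classical in
/-- The curve `L`: the union, over the triangles of `τ` with vertices of different signs, of the
midline that separates the vertex `a` whose sign occurs once from the other two vertices
`b` and `c`. Only the values of `σ` at the vertices of `τ` matter. -/
def plCurve (τ : Geometry.SimplicialComplex ℝ (ℝ × ℝ)) (σ : ℕ × ℕ → ℤˣ) : Set (ℝ × ℝ) :=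
  {q | ∃ a b c : ℕ × ℕ,
    ({latticePoint a, latticePoint b, latticePoint c} : Finset (ℝ × ℝ)) ∈ triangles τ ∧
    σ a ≠ σ b ∧ σ a ≠ σ c ∧
    q ∈ segment ℝ (midpoint ℝ (latticePoint a) (latticePoint b))
      (midpoint ℝ (latticePoint a) (latticePoint c))}

/-- The polynomial `b_t(x, y) = ∑ σ(k,l) t ^ ν(k,l) x ^ k y ^ l`, summed over the vertices `(k, l)`
of `τ`. -/
def patchPoly (m : ℕ) (τ : Geometry.SimplicialComplex ℝ (ℝ × ℝ)) (σ : ℕ × ℕ → ℤˣ)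
    (ν : ℝ × ℝ → ℝ) (t : ℝ) : MvPolynomial (Fin 2) ℝ :=
  ∑ p ∈ vertexFinset m τ,
    MvPolynomial.C (((σ p : ℤ) : ℝ) * t ^ ν (latticePoint p)) *
      MvPolynomial.X 0 ^ p.1 * MvPolynomial.X 1 ^ p.2

/-- The open first quadrant. -/
def openQuadrant : Set (ℝ × ℝ) := {q | 0 < q.1 ∧ 0 < q.2}

/-- The curve defined by the polynomial `b` in the open first quadrant. -/
def curveInQuadrant (b : MvPolynomial (Fin 2) ℝ) : Set (ℝ × ℝ) :=
  {q | q ∈ openQuadrant ∧ MvPolynomial.eval ![q.1, q.2] b = 0}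

/-- The pairs `(X, A)` and `(Y, B)`, where `A ⊆ X` and `B ⊆ Y`, are homeomorphic: some
homeomorphism `X → Y` maps `A` onto `B`. -/
def PairHomeomorphic {E F : Type*} [TopologicalSpace E] [TopologicalSpace F]
    (X A : Set E) (Y B : Set F) : Prop :=
  ∃ φ : X ≃ₜ Y, φ '' (Subtype.val ⁻¹' A) = Subtype.val ⁻¹' B

end Patchwork

end

open Filter Topology

noncomputable section

namespace Patchwork

/-! Put x = exp w₁, y = exp w₂, t = exp (-N). Then b_t is a positive factor Z(w) times the mean of
the vertex signs under the probability weights proportional to exp (⟨v, w⟩ - N ν v), so a_t is the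
locus where the mean sign vanishes (`eval_patchPoly_eq_zero_iff`). The map sending w to the
barycenter μ(w) of these weights is the gradient of the convex function log Z and a homeomorphism of
the plane onto Int Δ (`exists_homeomorph_momentMap`). The mean sign thus becomes a function on Int
Δ, to be compared with the piecewise linear interpolation of the signs, whose zero set there is L
(`mem_plCurve_iff`).

Convexity of ν makes the two close. If the barycenter lies in a triangle T, then at every vertex
outside T the value of ν exceeds, by a definite gap, the affine function equal to ν on T. Since
entropy is bounded independently of N, the mass outside T is O(1/N) (`eventually_sum_gibbs_le`), and
the deviation E of the mean sign from the interpolated sign is uniformly small.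

Uniform smallness does not fix the topology of a zero set; E must also vary slowly in a direction
transverse to L. In a triangle with both signs one vertex is alone with its sign, and the rays to it
cross the midline. The variation of E along them is bounded without derivatives: J = ⟨μ(w') - μ(w),
w' - w⟩ is a symmetrised relative entropy, it is O(ρ²) for a step of relative length ρ towards a
vertex of substantial mass (`dot_momentMap_sub_le`), and by Cauchy–Schwarz the weights outside T
change by at most √(2εJ) when their total mass is at most ε (`sum_abs_gibbs_sub_sq_le`).

Where the interpolated sign lies strictly between -1 and 1, conditioning barycentric coordinates on
the sign and mixing the two conditional barycenters gives segments, the leaves, compatible with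
common faces. Along the relevant part of a leaf the interpolated sign plus a cut-off multiple of E
is strictly increasing, so sliding points along leaves is a homeomorphism of Int Δ that carries the
zero set of the mean sign to L. -/

/-- The standard pairing on the plane. -/
def dot (p w : ℝ × ℝ) : ℝ := p.1 * w.1 + p.2 * w.2

lemma dot_sub_right (p w w' : ℝ × ℝ) : dot p (w - w') = dot p w - dot p w' := by
  simp [dot]; ring

lemma dot_sub_left (p p' w : ℝ × ℝ) : dot (p - p') w = dot p w - dot p' w := by
  simp [dot]; ring

lemma dot_smul_left (r : ℝ) (p w : ℝ × ℝ) : dot (r • p) w = r * dot p w := by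
  simp [dot]; ring

lemma dot_sum_left {ι : Type*} (s : Finset ι) (f : ι → ℝ × ℝ) (w : ℝ × ℝ) :
    dot (∑ i ∈ s, f i) w = ∑ i ∈ s, dot (f i) w := by
  simp [dot, Prod.fst_sum, Prod.snd_sum, Finset.sum_mul, Finset.sum_add_distrib]

/-! ### Gibbs distributions and entropy inequalities -/

/-- The partition function of the weights `exp (⟨v, w⟩ + c v)`. -/
def partitionFn (V : Finset (ℝ × ℝ)) (c : ℝ × ℝ → ℝ) (w : ℝ × ℝ) : ℝ :=
  ∑ v ∈ V, Real.exp (dot v w + c v)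

/-- The Gibbs distribution with weights `exp (⟨v, w⟩ + c v)`. -/
def gibbs (V : Finset (ℝ × ℝ)) (c : ℝ × ℝ → ℝ) (w v : ℝ × ℝ) : ℝ :=
  Real.exp (dot v w + c v) / partitionFn V c w

/-- The moment map: the barycenter of the Gibbs distribution. -/
def momentMap (V : Finset (ℝ × ℝ)) (c : ℝ × ℝ → ℝ) (w : ℝ × ℝ) : ℝ × ℝ :=
  ∑ v ∈ V, gibbs V c w v • v

section Gibbs

variable {V : Finset (ℝ × ℝ)} {c : ℝ × ℝ → ℝ}

lemma partitionFn_pos (hV : V.Nonempty) (w : ℝ × ℝ) : 0 < partitionFn V c w :=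
  Finset.sum_pos (fun _ _ => Real.exp_pos _) hV

lemma gibbs_pos (hV : V.Nonempty) (w v : ℝ × ℝ) : 0 < gibbs V c w v :=
  div_pos (Real.exp_pos _) (partitionFn_pos hV w)

lemma sum_gibbs (hV : V.Nonempty) (w : ℝ × ℝ) : ∑ v ∈ V, gibbs V c w v = 1 := by
  simp only [gibbs]
  rw [← Finset.sum_div]
  exact div_self (partitionFn_pos hV w).ne'

lemma gibbs_le_one (hV : V.Nonempty) (w : ℝ × ℝ) {v : ℝ × ℝ} (hv : v ∈ V) :
    gibbs V c w v ≤ 1 := by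
  rw [← sum_gibbs (c := c) hV w]
  exact Finset.single_le_sum (fun u _ => (gibbs_pos hV w u).le) hv

lemma log_gibbs (hV : V.Nonempty) (w v : ℝ × ℝ) :
    Real.log (gibbs V c w v) = dot v w + c v - Real.log (partitionFn V c w) := by
  rw [gibbs, Real.log_div (Real.exp_pos _).ne' (partitionFn_pos hV w).ne', Real.log_exp]

lemma dot_momentMap (w u : ℝ × ℝ) :
    dot (momentMap V c w) u = ∑ v ∈ V, gibbs V c w v * dot v u := by
  simp [momentMap, dot_sum_left, dot_smul_left]

lemma continuous_dot (v : ℝ × ℝ) : Continuous (dot v) := by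
  unfold dot; fun_prop

lemma continuous_partitionFn : Continuous (partitionFn V c) := by
  have := continuous_dot
  unfold partitionFn
  fun_prop

lemma continuous_gibbs (hV : V.Nonempty) (v : ℝ × ℝ) :
    Continuous fun w => gibbs V c w v := by
  have := continuous_dot v
  have h2 : Continuous fun w => Real.exp (dot v w + c v) := by fun_prop
  exact h2.div continuous_partitionFn fun w => (partitionFn_pos hV w).ne'

lemma continuous_momentMap (hV : V.Nonempty) : Continuous (momentMap V c) :=
  continuous_finsetSum _ fun v _ => (continuous_gibbs hV v).smul continuous_const

/-- The gradient inequality for the convex function `log (partitionFn V c)`. -/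
lemma dot_momentMap_le (hV : V.Nonempty) (w w' : ℝ × ℝ) :
    dot (momentMap V c w) (w' - w) ≤
      Real.log (partitionFn V c w') - Real.log (partitionFn V c w) := by
  -- Gibbs' inequality: relative entropy is nonnegative, by log x ≤ x - 1.
  have key : ∑ v ∈ V, gibbs V c w v * (Real.log (gibbs V c w' v) - Real.log (gibbs V c w v))
      ≤ 0 := by
    have h1 : ∀ v ∈ V,
        gibbs V c w v * (Real.log (gibbs V c w' v) - Real.log (gibbs V c w v)) ≤
          gibbs V c w' v - gibbs V c w v := by
      intro v _
      have p := gibbs_pos (c := c) hV w v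
      have p' := gibbs_pos (c := c) hV w' v
      rw [← Real.log_div p'.ne' p.ne']
      have := Real.log_le_sub_one_of_pos (div_pos p' p)
      calc _ ≤ gibbs V c w v * (gibbs V c w' v / gibbs V c w v - 1) := by gcongr
        _ = _ := by field_simp
    refine (Finset.sum_le_sum h1).trans ?_
    simp [sum_gibbs hV]
  have h2 : ∑ v ∈ V, gibbs V c w v * (Real.log (gibbs V c w' v) - Real.log (gibbs V c w v)) =
      dot (momentMap V c w) (w' - w) -
        (Real.log (partitionFn V c w') - Real.log (partitionFn V c w)) := by
    rw [dot_momentMap]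
    conv_rhs => rw [← one_mul (Real.log (partitionFn V c w') - _), ← sum_gibbs (c := c) hV w,
      Finset.sum_mul, ← Finset.sum_sub_distrib]
    refine Finset.sum_congr rfl fun v _ => ?_
    rw [log_gibbs hV, log_gibbs hV, dot_sub_right]
    ring
  linarith

/-- The symmetrised relative entropy of two Gibbs distributions. -/
lemma dot_momentMap_sub (hV : V.Nonempty) (w w' : ℝ × ℝ) :
    dot (momentMap V c w' - momentMap V c w) (w' - w) =
      ∑ v ∈ V, (gibbs V c w' v - gibbs V c w v) *
        (Real.log (gibbs V c w' v) - Real.log (gibbs V c w v)) := by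
  have h : ∀ v ∈ V, (gibbs V c w' v - gibbs V c w v) *
        (Real.log (gibbs V c w' v) - Real.log (gibbs V c w v)) =
      (gibbs V c w' v * dot v (w' - w) - gibbs V c w v * dot v (w' - w)) -
      (gibbs V c w' v * (Real.log (partitionFn V c w') - Real.log (partitionFn V c w)) -
        gibbs V c w v * (Real.log (partitionFn V c w') - Real.log (partitionFn V c w))) := by
    intro v _
    rw [log_gibbs hV, log_gibbs hV, dot_sub_right]
    ring
  rw [Finset.sum_congr rfl h, dot_sub_left, dot_momentMap, dot_momentMap]
  simp only [Finset.sum_sub_distrib, ← Finset.sum_mul, sum_gibbs hV]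
  ring

/-- The slope of log between x and y is at least 1 / max x y. Keeping the maximum, rather than
bounding it by 1, is what later yields a gain when the weights are small. -/
lemma sq_sub_le_max_mul {x y : ℝ} (hx : 0 < x) (hy : 0 < y) :
    (x - y) ^ 2 ≤ max x y * ((x - y) * (Real.log x - Real.log y)) := by
  wlog h : y ≤ x generalizing x y
  · have := this hy hx (le_of_not_ge h)
    rw [max_comm] at this
    nlinarith
  rw [max_eq_left h, ← Real.log_div hx.ne' hy.ne']
  have h1 := Real.one_sub_inv_le_log_of_pos (div_pos hx hy)
  have h2 : x * (1 - (x / y)⁻¹) = x - y := by field_simp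
  have h3 : x - y ≤ x * Real.log (x / y) := by
    rw [← h2]; gcongr
  nlinarith [sub_nonneg.2 h]

lemma sub_mul_log_sub_nonneg {x y : ℝ} (hx : 0 < x) (hy : 0 < y) :
    0 ≤ (x - y) * (Real.log x - Real.log y) :=
  nonneg_of_mul_nonneg_right ((sq_nonneg _).trans (sq_sub_le_max_mul hx hy)) (lt_max_of_lt_left hx)

lemma sq_gibbs_sub_le (hV : V.Nonempty) (w w' : ℝ × ℝ) {v : ℝ × ℝ} (hv : v ∈ V) :
    (gibbs V c w' v - gibbs V c w v) ^ 2 ≤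
      dot (momentMap V c w' - momentMap V c w) (w' - w) := by
  rw [dot_momentMap_sub hV]
  have p := gibbs_pos (c := c) hV w
  have p' := gibbs_pos (c := c) hV w'
  refine le_trans ?_ (Finset.single_le_sum
    (fun u _ => sub_mul_log_sub_nonneg (p' u) (p u)) hv)
  refine (sq_sub_le_max_mul (p' v) (p v)).trans ?_
  exact mul_le_of_le_one_left (sub_mul_log_sub_nonneg (p' v) (p v))
    (max_le (gibbs_le_one hV _ hv) (gibbs_le_one hV _ hv))

/-- Cauchy–Schwarz, splitting each squared difference into the larger weight times its entropy term.
The larger weights sum to at most 2ε, so a set of small mass changes little compared with the total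
entropy. -/
lemma sum_abs_gibbs_sub_sq_le (hV : V.Nonempty) (w w' : ℝ × ℝ) {S : Finset (ℝ × ℝ)}
    (hS : S ⊆ V) {ε : ℝ} (h : ∑ v ∈ S, gibbs V c w v ≤ ε) (h' : ∑ v ∈ S, gibbs V c w' v ≤ ε) :
    (∑ v ∈ S, |gibbs V c w' v - gibbs V c w v|) ^ 2 ≤
      2 * ε * dot (momentMap V c w' - momentMap V c w) (w' - w) := by
  have p := gibbs_pos (c := c) hV w
  have p' := gibbs_pos (c := c) hV w'
  have h1 : (∑ v ∈ S, |gibbs V c w' v - gibbs V c w v|) ^ 2 ≤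
      (∑ v ∈ S, max (gibbs V c w' v) (gibbs V c w v)) *
      ∑ v ∈ S, (gibbs V c w' v - gibbs V c w v) *
        (Real.log (gibbs V c w' v) - Real.log (gibbs V c w v)) := by
    refine Finset.sum_sq_le_sum_mul_sum_of_sq_le_mul _ (fun v _ => (lt_max_of_lt_left (p' v)).le)
      (fun v _ => sub_mul_log_sub_nonneg (p' v) (p v)) fun v _ => ?_
    rw [sq_abs]
    exact sq_sub_le_max_mul (p' v) (p v)
  have h2 : ∑ v ∈ S, max (gibbs V c w' v) (gibbs V c w v) ≤ 2 * ε := by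
    have : ∑ v ∈ S, max (gibbs V c w' v) (gibbs V c w v) ≤
        ∑ v ∈ S, (gibbs V c w' v + gibbs V c w v) :=
      Finset.sum_le_sum fun v _ => max_le (by linarith [p v]) (by linarith [p' v])
    rw [Finset.sum_add_distrib] at this
    linarith
  refine h1.trans ?_
  rw [dot_momentMap_sub hV]
  have hε : 0 ≤ ε := (Finset.sum_nonneg fun v _ => (p v).le).trans h
  refine mul_le_mul h2 (Finset.sum_le_sum_of_subset_of_nonneg hS fun v _ _ =>
    sub_mul_log_sub_nonneg (p' v) (p v)) (Finset.sum_nonneg fun v _ =>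
    sub_mul_log_sub_nonneg (p' v) (p v)) (by positivity)

/-- Moving the barycenter towards a vertex `a` of substantial weight moves the Gibbs distribution
at a controlled rate. -/
lemma dot_momentMap_sub_le (hV : V.Nonempty) {w w' a : ℝ × ℝ} (ha : a ∈ V) {ρ κ : ℝ}
    (hρ : 0 ≤ ρ) (hρ' : ρ ≤ 3 / 5) (hκ : 0 < κ) (hκa : κ ≤ gibbs V c w a)
    (h : momentMap V c w' = momentMap V c w + ρ • (a - momentMap V c w)) :
    dot (momentMap V c w' - momentMap V c w) (w' - w) ≤ (5 * ρ / (2 * κ)) ^ 2 := by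
  set J := dot (momentMap V c w' - momentMap V c w) (w' - w) with hJ
  set x := dot (a - momentMap V c w) (w' - w) with hx
  have p := gibbs_pos (c := c) hV w a
  have p' := gibbs_pos (c := c) hV w' a
  have hJx : J = ρ * x := by
    rw [hJ, h, add_sub_cancel_left, dot_smul_left]
  have hsq := sq_gibbs_sub_le (c := c) hV w w' ha
  rw [← hJ] at hsq
  have hJ0 : 0 ≤ J := (sq_nonneg _).trans hsq
  have h1 : Real.log (gibbs V c w' a) - Real.log (gibbs V c w a) =
      dot a (w' - w) - (Real.log (partitionFn V c w') - Real.log (partitionFn V c w)) := by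
    rw [log_gibbs hV, log_gibbs hV, dot_sub_right]; ring
  have h2 := dot_momentMap_le (c := c) hV w' w
  have h3 : dot (momentMap V c w') (w - w') = - dot (momentMap V c w') (w' - w) := by
    rw [dot_sub_right, dot_sub_right]; ring
  -- The gradient inequality at `w'` bounds the change of log Z above by the pairing of `momentMap V
  -- c w'` with `w' - w`.
  have h4 : x - J ≤ Real.log (gibbs V c w' a) - Real.log (gibbs V c w a) := by
    rw [h1, hx, hJ, dot_sub_left, dot_sub_left]; linarith
  have h5 : Real.log (gibbs V c w' a) - Real.log (gibbs V c w a) ≤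
      |gibbs V c w' a - gibbs V c w a| / κ := by
    rw [← Real.log_div p'.ne' p.ne']
    have := Real.log_le_sub_one_of_pos (div_pos p' p)
    calc _ ≤ gibbs V c w' a / gibbs V c w a - 1 := this
      _ = (gibbs V c w' a - gibbs V c w a) / gibbs V c w a := by field_simp
      _ ≤ |gibbs V c w' a - gibbs V c w a| / gibbs V c w a := by gcongr; exact le_abs_self _
      _ ≤ _ := by gcongr
  have h6 : |gibbs V c w' a - gibbs V c w a| ≤ √J := Real.abs_le_sqrt hsq
  have h7 : x - J ≤ √J / κ := h4.trans (h5.trans (by gcongr))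
  -- Here J = ρx, so x - J = (1 - ρ)x, and 1 - ρ ≥ 2/5. Thus J is at most a multiple of ρ√J;
  -- dividing by √J makes J quadratic in ρ.
  have h8 : J ≤ 5 * ρ / (2 * κ) * √J := by
    have : (2 / 5) * x ≤ √J / κ := by
      by_cases hx0 : 0 ≤ x
      · nlinarith
      · have : 0 ≤ √J / κ := by positivity
        linarith
    calc J = (5 / 2 * ρ) * ((2 / 5) * x) := by rw [hJx]; ring
      _ ≤ (5 / 2 * ρ) * (√J / κ) := by gcongr
      _ = _ := by field_simp
  have h9 : √J ≤ 5 * ρ / (2 * κ) := by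
    rcases hJ0.eq_or_lt with h0 | h0
    · rw [← h0, Real.sqrt_zero]; positivity
    · have hs := Real.sqrt_pos.2 h0
      refine le_of_mul_le_mul_right ?_ hs
      rwa [Real.mul_self_sqrt hJ0]
  calc J = √J ^ 2 := (Real.sq_sqrt hJ0).symm
    _ ≤ _ := by gcongr

/-- The variational principle for the Gibbs distribution, up to the entropy term. -/
lemma sum_mul_sub_sum_gibbs_mul_le (hV : V.Nonempty) {w : ℝ × ℝ} {β : ℝ × ℝ → ℝ}
    (h0 : ∀ v ∈ V, 0 ≤ β v) (h1 : ∑ v ∈ V, β v = 1)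
    (h : ∑ v ∈ V, β v • v = momentMap V c w) :
    ∑ v ∈ V, β v * c v - ∑ v ∈ V, gibbs V c w v * c v ≤ V.card := by
  have e1 : ∑ v ∈ V, β v * Real.log (gibbs V c w v) =
      dot (momentMap V c w) w + ∑ v ∈ V, β v * c v - Real.log (partitionFn V c w) := by
    rw [← h, dot_sum_left, ← Finset.sum_add_distrib]
    conv_rhs => rw [← one_mul (Real.log (partitionFn V c w)), ← h1, Finset.sum_mul,
      ← Finset.sum_sub_distrib]
    refine Finset.sum_congr rfl fun v _ => ?_
    rw [log_gibbs hV, dot_smul_left]; ring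
  have e2 : ∑ v ∈ V, gibbs V c w v * Real.log (gibbs V c w v) =
      dot (momentMap V c w) w + ∑ v ∈ V, gibbs V c w v * c v - Real.log (partitionFn V c w) := by
    rw [momentMap, dot_sum_left, ← Finset.sum_add_distrib]
    conv_rhs => rw [← one_mul (Real.log (partitionFn V c w)), ← sum_gibbs (c := c) hV w,
      Finset.sum_mul, ← Finset.sum_sub_distrib]
    refine Finset.sum_congr rfl fun v _ => ?_
    rw [log_gibbs hV, dot_smul_left]; ring
  -- Equal barycenters make the linear terms and log Z cancel in e1 - e2. What remains is bounded by
  -- signs of logarithms and by p log p ≥ p - 1 ≥ -1, independently of `c`.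
  have e3 : ∑ v ∈ V, β v * Real.log (gibbs V c w v) ≤ 0 :=
    Finset.sum_nonpos fun v hv => mul_nonpos_of_nonneg_of_nonpos (h0 v hv)
      (Real.log_nonpos (gibbs_pos hV w v).le (gibbs_le_one hV w hv))
  have e4 : -(V.card : ℝ) ≤ ∑ v ∈ V, gibbs V c w v * Real.log (gibbs V c w v) := by
    have : ∑ v ∈ V, (-1 : ℝ) ≤ ∑ v ∈ V, gibbs V c w v * Real.log (gibbs V c w v) := by
      refine Finset.sum_le_sum fun v hv => ?_
      have p := gibbs_pos (c := c) hV w v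
      have := Real.one_sub_inv_le_log_of_pos p
      have h3 : gibbs V c w v * (1 - (gibbs V c w v)⁻¹) ≤
        gibbs V c w v * Real.log (gibbs V c w v) := by gcongr
      have h4 : gibbs V c w v * (1 - (gibbs V c w v)⁻¹) = gibbs V c w v - 1 := by field_simp
      linarith
    simpa using this
  linarith

end Gibbs

/-! ### The moment map as a homeomorphism onto the interior of the triangle -/

/-- The points of the triangle at depth at least `δ`. -/
def deepPart (m : ℕ) (δ : ℝ) : Set (ℝ × ℝ) := {q | δ ≤ q.1 ∧ δ ≤ q.2 ∧ q.1 + q.2 ≤ m - δ}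

lemma bigTriangle_eq {m : ℕ} (hm : 0 < m) : bigTriangle m = deepPart m 0 := by
  have hm' : (0 : ℝ) < m := by exact_mod_cast hm
  apply Set.Subset.antisymm
  · refine convexHull_min ?_ ?_
    · rintro q (rfl | rfl | rfl) <;> simp [deepPart]
    · rintro p ⟨h1, h2, h3⟩ q ⟨k1, k2, k3⟩ a b ha hb hab
      have : b = 1 - a := by linarith
      subst this
      refine ⟨?_, ?_, ?_⟩ <;> simp <;> nlinarith
  · rintro ⟨x, y⟩ ⟨h1, h2, h3⟩
    simp only [sub_zero] at h3
    have key := (convex_convexHull ℝ ({((0 : ℝ), (0 : ℝ)), ((m : ℝ), (0 : ℝ)), ((0 : ℝ), (m : ℝ))} :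
      Set (ℝ × ℝ))).sum_mem (t := Finset.univ) (w := ![1 - x / m - y / m, x / m, y / m])
      (z := ![((0 : ℝ), (0 : ℝ)), ((m : ℝ), (0 : ℝ)), ((0 : ℝ), (m : ℝ))]) ?_ ?_ ?_
    · refine Set.mem_of_eq_of_mem ?_ key
      simp [Fin.sum_univ_three, hm'.ne']
    · intro i _
      fin_cases i
      · have : x / m + y / m ≤ 1 := by rw [← add_div, div_le_one hm']; exact h3
        change 0 ≤ 1 - x / m - y / m
        linarith
      · exact div_nonneg h1 hm'.le
      · exact div_nonneg h2 hm'.le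
    · simp [Fin.sum_univ_three]
      ring
    · intro i _
      apply subset_convexHull
      fin_cases i <;> simp

lemma mem_interior_bigTriangle {m : ℕ} (hm : 0 < m) {q : ℝ × ℝ} :
    q ∈ interior (bigTriangle m) ↔ 0 < q.1 ∧ 0 < q.2 ∧ q.1 + q.2 < m := by
  rw [bigTriangle_eq hm]
  constructor
  · intro h
    have hn : deepPart m 0 ∈ 𝓝 q := mem_interior_iff_mem_nhds.1 h
    have shift : ∀ e : ℝ × ℝ, ∃ r > (0 : ℝ), q + r • e ∈ deepPart m 0 := by
      intro e
      have hc : Tendsto (fun r : ℝ => q + r • e) (𝓝[>] 0) (𝓝 q) := by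
        have : Continuous fun r : ℝ => q + r • e := by fun_prop
        have h := this.tendsto 0
        simp only [zero_smul, add_zero] at h
        exact h.mono_left nhdsWithin_le_nhds
      have := (hc.eventually hn).and self_mem_nhdsWithin
      obtain ⟨r, hr, hr0⟩ := this.exists
      exact ⟨r, hr0, hr⟩
    obtain ⟨r, hr, h1⟩ := shift (-1, 0)
    obtain ⟨r', hr', h2⟩ := shift (0, -1)
    obtain ⟨r'', hr'', h3⟩ := shift (1, 0)
    simp [deepPart] at h1 h2 h3
    exact ⟨by linarith, by linarith, by linarith⟩
  · rintro ⟨h1, h2, h3⟩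
    refine mem_interior.2 ⟨{q | 0 < q.1 ∧ 0 < q.2 ∧ q.1 + q.2 < m}, ?_, ?_, h1, h2, h3⟩
    · rintro q ⟨h1, h2, h3⟩
      exact ⟨h1.le, h2.le, by simpa using h3.le⟩
    · exact (isOpen_lt continuous_const continuous_fst).inter
        ((isOpen_lt continuous_const continuous_snd).inter
          (isOpen_lt (continuous_fst.add continuous_snd) continuous_const))

lemma mem_interior_iff_exists_deepPart {m : ℕ} (hm : 0 < m) {q : ℝ × ℝ} :
    q ∈ interior (bigTriangle m) ↔ ∃ δ > 0, q ∈ deepPart m δ := by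
  rw [mem_interior_bigTriangle hm]
  constructor
  · rintro ⟨h1, h2, h3⟩
    refine ⟨min q.1 (min q.2 (m - (q.1 + q.2))),
      lt_min h1 (lt_min h2 (by linarith)), min_le_left _ _,
      (min_le_right _ _).trans (min_le_left _ _), ?_⟩
    have := (min_le_right q.1 (min q.2 (m - (q.1 + q.2)))).trans (min_le_right _ _)
    linarith
  · rintro ⟨δ, hδ, h1, h2, h3⟩
    exact ⟨by linarith, by linarith, by linarith⟩

/-- A continuous injection of the plane onto the interior of the triangle that is proper is a
homeomorphism. -/
lemma exists_homeomorph_of_proper {m : ℕ} (hm : 0 < m) {f : ℝ × ℝ → ℝ × ℝ} (hf : Continuous f)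
    (hinj : Function.Injective f) (hrange : Set.range f = interior (bigTriangle m))
    (hproper : ∀ δ > 0, ∃ R, ∀ w, f w ∈ deepPart m δ → ‖w‖ ≤ R) :
    ∃ φ : ℝ × ℝ ≃ₜ interior (bigTriangle m), ∀ w, (φ w : ℝ × ℝ) = f w := by
  have hmem : ∀ w, f w ∈ interior (bigTriangle m) := fun w => hrange ▸ Set.mem_range_self w
  let g : ℝ × ℝ → interior (bigTriangle m) := fun w => ⟨f w, hmem w⟩
  have hg : Continuous g := hf.subtype_mk hmem
  have hbij : Function.Bijective g := by
    refine ⟨fun x y h => hinj (congrArg Subtype.val h), fun ⟨q, hq⟩ => ?_⟩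
    rw [← hrange] at hq
    obtain ⟨w, hw⟩ := hq
    exact ⟨w, Subtype.ext hw⟩
  have : LocallyCompactSpace (interior (bigTriangle m)) :=
    isOpen_interior.locallyCompactSpace
  have hp : IsProperMap g := by
    rw [isProperMap_iff_isCompact_preimage]
    refine ⟨hg, fun K hK => ?_⟩
    rcases K.eq_empty_or_nonempty with rfl | hne
    · simp
    -- The depth is continuous and positive, so it has a positive minimum on the compact set K.
    have hd : ∃ δ > 0, ∀ q ∈ K, (q : ℝ × ℝ) ∈ deepPart m δ := by
      have hcont : ContinuousOn (fun q : interior (bigTriangle m) =>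
          min q.1.1 (min q.1.2 (m - (q.1.1 + q.1.2)))) K := by fun_prop
      obtain ⟨q₀, _, hmin⟩ := hK.exists_isMinOn hne hcont
      obtain ⟨h1, h2, h3⟩ := (mem_interior_bigTriangle hm).1 q₀.2
      refine ⟨_, lt_min h1 (lt_min h2 (sub_pos.2 h3)), fun q hq => ?_⟩
      have := hmin hq
      simp only [Set.mem_ofPred_eq] at this
      refine ⟨this.trans (min_le_left _ _),
        this.trans ((min_le_right _ _).trans (min_le_left _ _)), ?_⟩
      have := this.trans ((min_le_right _ _).trans (min_le_right _ _))
      linarith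
    obtain ⟨δ, hδ, hK'⟩ := hd
    obtain ⟨R, hR⟩ := hproper δ hδ
    refine (isCompact_closedBall (0 : ℝ × ℝ) R).of_isClosed_subset (hK.isClosed.preimage hg) ?_
    intro w hw
    rw [mem_closedBall_zero_iff]
    exact hR w (hK' _ hw)
  exact ⟨(Equiv.ofBijective g hbij).toHomeomorphOfContinuousClosed hg hp.isClosedMap,
    fun w => rfl⟩

section MomentMap

variable {m : ℕ} {V : Finset (ℝ × ℝ)} {c : ℝ × ℝ → ℝ}

lemma dot_le_of_forall_vertices (hV : bigTriangle m ⊆ convexHull ℝ (V : Set (ℝ × ℝ)))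
    {w : ℝ × ℝ} {M : ℝ} (h : ∀ v ∈ V, dot v w ≤ M) {p : ℝ × ℝ} (hp : p ∈ bigTriangle m) :
    dot p w ≤ M := by
  have hc : Convex ℝ {v : ℝ × ℝ | dot v w ≤ M} := by
    intro p hp q hq a b ha hb hab
    have : dot (a • p + b • q) w = a * dot p w + b * dot q w := by simp [dot]; ring
    simp only [Set.mem_ofPred_eq] at hp hq ⊢
    rw [this]
    calc _ ≤ a * M + b * M := by gcongr
      _ = M := by rw [← add_mul, hab, one_mul]
  exact convexHull_min (fun v hv => h v hv) hc (hV hp)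

lemma corner_mem_bigTriangle (m : ℕ) : ((0 : ℝ), (0 : ℝ)) ∈ bigTriangle m ∧
    ((m : ℝ), (0 : ℝ)) ∈ bigTriangle m ∧ ((0 : ℝ), (m : ℝ)) ∈ bigTriangle m :=
  ⟨subset_convexHull _ _ (by simp), subset_convexHull _ _ (by simp),
    subset_convexHull _ _ (by simp)⟩

/-- The bound on the vertices passes to the three corners of the triangle. Writing q through the
corners bounds ⟨q, w⟩ above, because q has depth δ; the corners then bound both coordinates of w
above, and ⟨q, w⟩ ≥ -M bounds them below. -/
lemma norm_le_of_dot_sub_le (hm : 0 < m)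
    (hV : bigTriangle m ⊆ convexHull ℝ (V : Set (ℝ × ℝ))) {δ : ℝ} (hδ : 0 < δ) (M : ℝ) :
    ∃ R, ∀ q ∈ deepPart m δ, ∀ w, (∀ v ∈ V, dot v w - dot q w ≤ M) → ‖w‖ ≤ R := by
  wlog hM : 0 ≤ M generalizing M
  · obtain ⟨R, hR⟩ := this 0 le_rfl
    exact ⟨R, fun q hq w h => hR q hq w fun v hv => (h v hv).trans (le_of_not_ge hM)⟩
  have hm' : (1 : ℝ) ≤ m := by exact_mod_cast hm
  refine ⟨(M + m * M / δ) + (M + m * (M + m * M / δ)) / δ, ?_⟩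
  rintro q ⟨hq1, hq2, hq3⟩ w h
  set A := dot q w with hA
  have hAe : A = q.1 * w.1 + q.2 * w.2 := rfl
  obtain ⟨c1, c2, c3⟩ := corner_mem_bigTriangle m
  have hh : ∀ v ∈ V, dot v w ≤ M + A := fun v hv => by linarith [h v hv]
  have k1 := dot_le_of_forall_vertices hV hh c1
  have k2 := dot_le_of_forall_vertices hV hh c2
  have k3 := dot_le_of_forall_vertices hV hh c3
  simp only [dot, zero_mul, add_zero, zero_add] at k1 k2 k3
  have e1 : δ * A ≤ m * M := by
    have : m * A ≤ (q.1 + q.2) * (M + A) := by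
      have : m * A = q.1 * (m * w.1) + q.2 * (m * w.2) := by rw [hAe]; ring
      rw [this, add_mul]
      gcongr
      · linarith
      · linarith
    have h2 : (q.1 + q.2) * (M + A) ≤ (m - δ) * (M + A) := by gcongr
    nlinarith
  have e2 : A ≤ m * M / δ := by rw [le_div_iff₀ hδ]; linarith
  set K := M + m * M / δ with hK
  have hK0 : 0 ≤ K := by positivity
  have u1 : w.1 ≤ K := by
    by_contra hcon
    push Not at hcon
    nlinarith
  have u2 : w.2 ≤ K := by
    by_contra hcon
    push Not at hcon
    nlinarith
  have l1 : -((M + m * K) / δ) ≤ w.1 := by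
    rw [neg_le, le_div_iff₀ hδ]
    by_cases hw : w.1 ≤ 0
    · have : -w.1 * δ ≤ -w.1 * q.1 := by gcongr; linarith
      have : q.2 * w.2 ≤ m * K := by
        calc q.2 * w.2 ≤ q.2 * K := by gcongr; linarith
          _ ≤ _ := by gcongr; linarith
      nlinarith
    · have : 0 ≤ M + m * K := by positivity
      nlinarith
  have l2 : -((M + m * K) / δ) ≤ w.2 := by
    rw [neg_le, le_div_iff₀ hδ]
    by_cases hw : w.2 ≤ 0
    · have : -w.2 * δ ≤ -w.2 * q.2 := by gcongr; linarith
      have : q.1 * w.1 ≤ m * K := by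
        calc q.1 * w.1 ≤ q.1 * K := by gcongr; linarith
          _ ≤ _ := by gcongr; linarith
      nlinarith
    · have : 0 ≤ M + m * K := by positivity
      nlinarith
  have hpos : 0 ≤ (M + m * K) / δ := by positivity
  rw [Prod.norm_def]
  refine max_le ?_ ?_ <;> rw [Real.norm_eq_abs, abs_le] <;> constructor <;> linarith

/-- Coercivity of w ↦ log Z(w) - ⟨q, w⟩, uniform over q of depth δ: log Z dominates each of its
exponents. -/
lemma norm_le_of_log_partitionFn_le (hm : 0 < m)
    (hV : bigTriangle m ⊆ convexHull ℝ (V : Set (ℝ × ℝ))) {δ : ℝ} (hδ : 0 < δ) (M : ℝ) :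
    ∃ R, ∀ q ∈ deepPart m δ, ∀ w, Real.log (partitionFn V c w) - dot q w ≤ M → ‖w‖ ≤ R := by
  obtain ⟨R, hR⟩ := norm_le_of_dot_sub_le hm hV hδ (M + ∑ v ∈ V, |c v|)
  refine ⟨R, fun q hq w h => hR q hq w fun v hv => ?_⟩
  have h1 : dot v w + c v ≤ Real.log (partitionFn V c w) := by
    rw [Real.le_log_iff_exp_le (partitionFn_pos ⟨v, hv⟩ w)]
    exact Finset.single_le_sum (f := fun v => Real.exp (dot v w + c v))
      (fun u _ => (Real.exp_pos _).le) hv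
  have h2 : |c v| ≤ ∑ v ∈ V, |c v| :=
    Finset.single_le_sum (f := fun v => |c v|) (fun u _ => abs_nonneg _) hv
  have h3 := neg_abs_le (c v)
  linarith

lemma nonempty_of_bigTriangle_subset (hV : bigTriangle m ⊆ convexHull ℝ (V : Set (ℝ × ℝ))) :
    V.Nonempty := by
  by_contra h
  rw [Finset.not_nonempty_iff_eq_empty] at h
  subst h
  have := hV (corner_mem_bigTriangle m).1
  simp at this

/-- Equal barycenters make the symmetrised entropy vanish, so the two Gibbs distributions agree.
Then `w' - w` pairs to a constant with all vertices, hence with the whole triangle, which forces it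
to vanish. -/
lemma momentMap_injective (hm : 0 < m) (hV : bigTriangle m ⊆ convexHull ℝ (V : Set (ℝ × ℝ))) :
    Function.Injective (momentMap V c) := by
  intro w w' h
  have hne := nonempty_of_bigTriangle_subset hV
  have hm' : (0 : ℝ) < m := by exact_mod_cast hm
  have h0 : ∀ v ∈ V, dot v (w' - w) =
      Real.log (partitionFn V c w') - Real.log (partitionFn V c w) := by
    intro v hv
    have := sq_gibbs_sub_le (c := c) hne w w' hv
    rw [h, sub_self] at this
    have h2 : gibbs V c w' v - gibbs V c w v = 0 := by
      have h3 : dot 0 (w' - w) = 0 := by simp [dot]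
      rw [h3] at this
      exact pow_eq_zero_iff (two_ne_zero) |>.1 (le_antisymm this (sq_nonneg _))
    have h3 : Real.log (gibbs V c w' v) = Real.log (gibbs V c w v) := by
      rw [sub_eq_zero.1 h2]
    rw [log_gibbs hne, log_gibbs hne] at h3
    rw [dot_sub_right]
    linarith
  set M := Real.log (partitionFn V c w') - Real.log (partitionFn V c w)
  have hneg : ∀ v, dot v (-(w' - w)) = - dot v (w' - w) := fun v => by simp [dot]; ring
  have h1 : ∀ p ∈ bigTriangle m, dot p (w' - w) = M := fun p hp => le_antisymm
    (dot_le_of_forall_vertices hV (fun v hv => (h0 v hv).le) hp) (by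
      have := dot_le_of_forall_vertices (w := -(w' - w)) (M := -M) hV
        (fun v hv => by rw [hneg, h0 v hv]) hp
      rw [hneg] at this
      linarith)
  obtain ⟨c1, c2, c3⟩ := corner_mem_bigTriangle m
  have k1 := h1 _ c1
  have k2 := h1 _ c2
  have k3 := h1 _ c3
  simp only [dot, zero_mul, add_zero, zero_add] at k1 k2 k3
  rw [← k1] at k2 k3
  have e1 := (mul_eq_zero.1 k2).resolve_left hm'.ne'
  have e2 := (mul_eq_zero.1 k3).resolve_left hm'.ne'
  simp only [Prod.fst_sub, Prod.snd_sub] at e1 e2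
  exact Prod.ext (by linarith) (by linarith)

/-- All weights are positive, so a linear function that is not constantly maximal on the vertices
has mean below its maximum; this is applied to the three sides. -/
lemma momentMap_mem_interior (hm : 0 < m) (hVe : convexHull ℝ (V : Set (ℝ × ℝ)) = bigTriangle m)
    (w : ℝ × ℝ) : momentMap V c w ∈ interior (bigTriangle m) := by
  have hne := nonempty_of_bigTriangle_subset hVe.ge
  have hm' : (0 : ℝ) < m := by exact_mod_cast hm
  have hVm : ∀ v ∈ V, v ∈ deepPart m 0 := fun v hv => by
    rw [← bigTriangle_eq hm, ← hVe]; exact subset_convexHull _ _ hv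
  have key : ∀ (u : ℝ × ℝ) (M : ℝ), (∀ v ∈ V, dot v u ≤ M) → (∃ p ∈ bigTriangle m, dot p u < M) →
      dot (momentMap V c w) u < M := by
    rintro u M h ⟨p, hp, hpM⟩
    have hex : ∃ v ∈ V, dot v u < M := by
      by_contra hcon
      push Not at hcon
      have hneg : ∀ v, dot v (-u) = - dot v u := fun v => by simp [dot]; ring
      have := dot_le_of_forall_vertices (w := -u) (M := -M) hVe.ge
        (fun v hv => by rw [hneg]; linarith [hcon v hv]) hp
      rw [hneg] at this
      linarith
    obtain ⟨v, hv, hvM⟩ := hex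
    rw [dot_momentMap]
    calc _ < ∑ v ∈ V, gibbs V c w v * M :=
          Finset.sum_lt_sum (fun v hv => mul_le_mul_of_nonneg_left (h v hv) (gibbs_pos hne w v).le)
            ⟨v, hv, mul_lt_mul_of_pos_left hvM (gibbs_pos hne w v)⟩
      _ = M := by rw [← Finset.sum_mul, sum_gibbs hne, one_mul]
  obtain ⟨c1, c2, c3⟩ := corner_mem_bigTriangle m
  rw [mem_interior_bigTriangle hm]
  have k1 := key (-1, 0) 0 (fun v hv => by simpa [dot] using (hVm v hv).1) ⟨_, c2, by simpa [dot]⟩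
  have k2 := key (0, -1) 0 (fun v hv => by simpa [dot] using (hVm v hv).2.1)
    ⟨_, c3, by simpa [dot]⟩
  have k3 := key (1, 1) m (fun v hv => by simpa [dot] using (hVm v hv).2.2)
    ⟨_, c1, by simpa [dot]⟩
  simp [dot] at k1 k2 k3
  exact ⟨k1, k2, k3⟩

/-- By coercivity log Z(w) - ⟨q, w⟩ attains its minimum, and a minimiser is a critical point, where
the gradient of log Z is q. -/
lemma exists_momentMap_eq (hm : 0 < m) (hV : bigTriangle m ⊆ convexHull ℝ (V : Set (ℝ × ℝ)))
    {q : ℝ × ℝ} (hq : q ∈ interior (bigTriangle m)) : ∃ w, momentMap V c w = q := by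
  have hne := nonempty_of_bigTriangle_subset hV
  obtain ⟨δ, hδ, hqδ⟩ := (mem_interior_iff_exists_deepPart hm).1 hq
  obtain ⟨R, hR⟩ := norm_le_of_log_partitionFn_le (c := c) hm hV hδ
    (Real.log (partitionFn V c 0) - dot q 0)
  have hcont : Continuous fun w => Real.log (partitionFn V c w) - dot q w :=
    (continuous_partitionFn.log fun w => (partitionFn_pos hne w).ne').sub (continuous_dot q)
  obtain ⟨w, hw⟩ := hcont.exists_forall_le' 0 (by
    filter_upwards [(isCompact_closedBall (0 : ℝ × ℝ) R).compl_mem_cocompact] with w hw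
    by_contra hcon
    push Not at hcon
    exact hw (mem_closedBall_zero_iff.2 (hR q hqδ w hcon.le)))
  -- The first-order condition without differentiation: the gradient inequality at w + ru together
  -- with minimality gives the sign for r > 0, and r tends to 0.
  have key : ∀ u, 0 ≤ dot (momentMap V c w - q) u := by
    intro u
    have hlim : Tendsto (fun r : ℝ => dot (momentMap V c (w + r • u) - q) u) (𝓝[>] 0)
        (𝓝 (dot (momentMap V c w - q) u)) := by
      have h1 : Continuous fun r : ℝ => dot (momentMap V c (w + r • u) - q) u := by
        have := continuous_momentMap (c := c) hne
        unfold dot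
        fun_prop
      have := h1.tendsto 0
      simp only [zero_smul, add_zero] at this
      exact this.mono_left nhdsWithin_le_nhds
    refine ge_of_tendsto hlim ?_
    filter_upwards [self_mem_nhdsWithin] with r hr
    have h1 := hw (w + r • u)
    have h2 := dot_momentMap_le (c := c) hne (w + r • u) w
    have e1 : dot (momentMap V c (w + r • u)) (w - (w + r • u)) =
      - (r * dot (momentMap V c (w + r • u)) u) := by simp [dot]; ring
    have e2 : dot q (w + r • u) = dot q w + r * dot q u := by simp [dot]; ring
    rw [e1] at h2
    rw [e2] at h1
    rw [dot_sub_left]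
    have : 0 ≤ r * (dot (momentMap V c (w + r • u)) u - dot q u) := by linarith
    exact nonneg_of_mul_nonneg_right this hr
  refine ⟨w, ?_⟩
  have k1 := key (1, 0)
  have k2 := key (-1, 0)
  have k3 := key (0, 1)
  have k4 := key (0, -1)
  simp [dot] at k1 k2 k3 k4
  exact Prod.ext (by linarith) (by linarith)

/-- Properness: the gradient inequality between w and 0 bounds log Z(w) - ⟨μ(w), w⟩ by log Z(0), and
coercivity is uniform in the barycenter. -/
lemma norm_le_of_momentMap_mem_deepPart (hm : 0 < m)
    (hV : bigTriangle m ⊆ convexHull ℝ (V : Set (ℝ × ℝ))) {δ : ℝ} (hδ : 0 < δ) :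
    ∃ R, ∀ w, momentMap V c w ∈ deepPart m δ → ‖w‖ ≤ R := by
  have hne := nonempty_of_bigTriangle_subset hV
  obtain ⟨R, hR⟩ := norm_le_of_log_partitionFn_le (c := c) hm hV hδ
    (Real.log (partitionFn V c 0))
  refine ⟨R, fun w hw => hR _ hw w ?_⟩
  have h := dot_momentMap_le (c := c) hne w 0
  have e : dot (momentMap V c w) (0 - w) = - dot (momentMap V c w) w := by simp [dot]; ring
  linarith

/-- The moment map is a homeomorphism of the plane onto the interior of the Newton polygon. -/
lemma exists_homeomorph_momentMap (hm : 0 < m)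
    (hV : convexHull ℝ (V : Set (ℝ × ℝ)) = bigTriangle m) :
    ∃ φ : ℝ × ℝ ≃ₜ interior (bigTriangle m), ∀ w, (φ w : ℝ × ℝ) = momentMap V c w :=
  exists_homeomorph_of_proper hm (continuous_momentMap (nonempty_of_bigTriangle_subset hV.ge))
    (momentMap_injective hm hV.ge)
    (Set.Subset.antisymm (Set.range_subset_iff.2 (momentMap_mem_interior hm hV))
      fun _ hq => exists_momentMap_eq hm hV.ge hq)
    fun _ hδ => norm_le_of_momentMap_mem_deepPart hm hV.ge hδ

end MomentMap

/-! ### Barycentric coordinates -/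

/-- `w` consists of barycentric coordinates of `q` with respect to `s`. -/
structure IsBarycentric (s : Finset (ℝ × ℝ)) (q : ℝ × ℝ) (w : ℝ × ℝ → ℝ) : Prop where
  nonneg : ∀ v, 0 ≤ w v
  eq_zero : ∀ v, v ∉ s → w v = 0
  sum_eq_one : ∑ v ∈ s, w v = 1
  sum_smul : ∑ v ∈ s, w v • v = q

lemma affineMap_sum_smul {s : Finset (ℝ × ℝ)} {w : ℝ × ℝ → ℝ} (h : ∑ v ∈ s, w v = 1)
    (f : (ℝ × ℝ) →ᵃ[ℝ] ℝ) : f (∑ v ∈ s, w v • v) = ∑ v ∈ s, w v * f v := by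
  have hf : ∀ x, f x = f.linear x + f 0 := fun x => by
    conv_lhs => rw [f.decomp]
    simp
  have h2 : ∑ v ∈ s, w v * f v = ∑ v ∈ s, (w v * f.linear v + w v * f 0) :=
    Finset.sum_congr rfl fun v _ => by rw [hf v, mul_add]
  rw [hf, h2, Finset.sum_add_distrib, ← Finset.sum_mul, h, one_mul, map_sum]
  simp only [map_smul, smul_eq_mul]

lemma exists_isBarycentric {s : Finset (ℝ × ℝ)} {q : ℝ × ℝ}
    (hq : q ∈ convexHull ℝ (s : Set (ℝ × ℝ))) : ∃ w, IsBarycentric s q w := by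
  classical
  obtain ⟨w, h0, h1, h2⟩ := Finset.mem_convexHull'.1 hq
  refine ⟨fun v => if v ∈ s then w v else 0, fun v => ?_, fun v hv => if_neg hv, ?_, ?_⟩
  · split_ifs with h
    exacts [h0 v h, le_rfl]
  · rw [← h1]
    exact Finset.sum_congr rfl fun v hv => if_pos hv
  · rw [← h2]
    exact Finset.sum_congr rfl fun v hv => by rw [if_pos hv]

namespace IsBarycentric

variable {s s' : Finset (ℝ × ℝ)} {q : ℝ × ℝ} {w w' : ℝ × ℝ → ℝ}

lemma mem_convexHull (h : IsBarycentric s q w) : q ∈ convexHull ℝ (s : Set (ℝ × ℝ)) :=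
  Finset.mem_convexHull'.2 ⟨w, fun v _ => h.nonneg v, h.sum_eq_one, h.sum_smul⟩

lemma mono (h : IsBarycentric s q w) (hs : s ⊆ s') : IsBarycentric s' q w where
  nonneg := h.nonneg
  eq_zero v hv := h.eq_zero v fun hv' => hv (hs hv')
  sum_eq_one := by
    rw [← h.sum_eq_one]
    exact (Finset.sum_subset hs fun v _ hv => h.eq_zero v hv).symm
  sum_smul := by
    rw [← h.sum_smul]
    exact (Finset.sum_subset hs fun v _ hv => by rw [h.eq_zero v hv, zero_smul]).symm

lemma unique (hs : AffineIndependent ℝ ((↑) : s → ℝ × ℝ)) (h : IsBarycentric s q w)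
    (h' : IsBarycentric s q w') : w = w' := by
  funext v
  by_cases hv : v ∈ s
  · exact hs.eq_of_sum_eq_sum_subtype (h.sum_eq_one.trans h'.sum_eq_one.symm)
      (h.sum_smul.trans h'.sum_smul.symm) v hv
  · rw [h.eq_zero v hv, h'.eq_zero v hv]

/-- Two faces meet in the hull of their common vertices, so both coordinate systems are supported
there and agree. Hence `bary` does not depend on the chosen face. -/
lemma unique_of_faces {τ : Geometry.SimplicialComplex ℝ (ℝ × ℝ)} (hs : s ∈ τ.faces)
    (hs' : s' ∈ τ.faces) (h : IsBarycentric s q w) (h' : IsBarycentric s' q w') : w = w' := by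
  classical
  have hq := τ.inter_subset_convexHull hs hs' ⟨h.mem_convexHull, h'.mem_convexHull⟩
  rw [← Finset.coe_inter] at hq
  obtain ⟨u, hu⟩ := exists_isBarycentric hq
  rw [h.unique (τ.indep hs) (hu.mono Finset.inter_subset_left),
    h'.unique (τ.indep hs') (hu.mono Finset.inter_subset_right)]

lemma affineMap_apply (h : IsBarycentric s q w) (f : (ℝ × ℝ) →ᵃ[ℝ] ℝ) :
    f q = ∑ v ∈ s, w v * f v := by
  rw [← h.sum_smul, affineMap_sum_smul h.sum_eq_one]

end IsBarycentric

open Classical in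
/-- The barycentric coordinates of a point with respect to a face of `τ` containing it. -/
def bary (τ : Geometry.SimplicialComplex ℝ (ℝ × ℝ)) (q : ℝ × ℝ) : ℝ × ℝ → ℝ :=
  if h : ∃ w, ∃ s ∈ τ.faces, IsBarycentric s q w then h.choose else 0

section Bary

variable {τ : Geometry.SimplicialComplex ℝ (ℝ × ℝ)} {s : Finset (ℝ × ℝ)} {q : ℝ × ℝ}

lemma bary_eq (hs : s ∈ τ.faces) {w : ℝ × ℝ → ℝ} (h : IsBarycentric s q w) : bary τ q = w := by
  have hex : ∃ w, ∃ s ∈ τ.faces, IsBarycentric s q w := ⟨w, s, hs, h⟩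
  rw [bary, dif_pos hex]
  obtain ⟨s', hs', h'⟩ := hex.choose_spec
  exact h'.unique_of_faces hs' hs h

lemma isBarycentric_bary (hs : s ∈ τ.faces) (hq : q ∈ convexHull ℝ (s : Set (ℝ × ℝ))) :
    IsBarycentric s q (bary τ q) := by
  obtain ⟨w, hw⟩ := exists_isBarycentric hq
  rwa [bary_eq hs hw]

end Bary

/-! ### The vertices and triangles of a lattice triangulation -/

open Classical in
/-- The vertices of `τ`, as points of the plane. -/
def vertexPoints (m : ℕ) (τ : Geometry.SimplicialComplex ℝ (ℝ × ℝ)) : Finset (ℝ × ℝ) :=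
  (vertexFinset m τ).image latticePoint

lemma latticePoint_injective : Function.Injective latticePoint := by
  rintro ⟨a, b⟩ ⟨c, d⟩ h
  simpa [latticePoint] using h

section Triangulation

variable {m : ℕ} {τ : Geometry.SimplicialComplex ℝ (ℝ × ℝ)}

lemma mem_vertexPoints (hm : 0 < m) (hτ : IsLatticeTriangulation m τ) {v : ℝ × ℝ} :
    v ∈ vertexPoints m τ ↔ v ∈ τ.vertices := by
  classical
  simp only [vertexPoints, vertexFinset, Finset.mem_image, Finset.mem_filter, Finset.mem_product,
    Finset.mem_range]
  constructor
  · rintro ⟨p, ⟨-, hp⟩, rfl⟩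
    exact hp
  · intro hv
    obtain ⟨k, l, rfl⟩ := hτ.integral v hv
    have h := τ.vertices_subset_space hv
    rw [hτ.space_eq, bigTriangle_eq hm] at h
    obtain ⟨h1, h2, h3⟩ := h
    simp only [sub_zero] at h3
    have k0 : 0 ≤ k := Int.cast_nonneg_iff.1 h1
    have l0 : 0 ≤ l := Int.cast_nonneg_iff.1 h2
    lift k to ℕ using k0
    lift l to ℕ using l0
    have h3' : k + l ≤ m := by exact_mod_cast h3
    exact ⟨(k, l), ⟨⟨by simp; omega, by simp; omega⟩, by simpa [latticePoint] using hv⟩,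
      by simp [latticePoint]⟩

lemma face_subset_vertexPoints (hm : 0 < m) (hτ : IsLatticeTriangulation m τ)
    {s : Finset (ℝ × ℝ)} (hs : s ∈ τ.faces) : s ⊆ vertexPoints m τ := by
  intro v hv
  rw [mem_vertexPoints hm hτ]
  exact τ.down_closed hs (Finset.singleton_subset_iff.2 hv) (Finset.singleton_nonempty v)

lemma finite_faces (hm : 0 < m) (hτ : IsLatticeTriangulation m τ) : τ.faces.Finite :=
  (vertexPoints m τ).powerset.finite_toSet.subset fun _ hs =>
    Finset.mem_coe.2 (Finset.mem_powerset.2 (face_subset_vertexPoints hm hτ hs))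

lemma finite_triangles (hm : 0 < m) (hτ : IsLatticeTriangulation m τ) : (triangles τ).Finite :=
  (finite_faces hm hτ).subset fun _ hs => hs.1

lemma convexHull_face_subset (hτ : IsLatticeTriangulation m τ)
    {s : Finset (ℝ × ℝ)} (hs : s ∈ τ.faces) :
    convexHull ℝ (s : Set (ℝ × ℝ)) ⊆ bigTriangle m :=
  hτ.space_eq ▸ τ.convexHull_subset_space hs

lemma convexHull_vertexPoints (hm : 0 < m) (hτ : IsLatticeTriangulation m τ) :
    convexHull ℝ (vertexPoints m τ : Set (ℝ × ℝ)) = bigTriangle m := by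
  apply Set.Subset.antisymm
  · refine convexHull_min (fun v hv => ?_) (convex_convexHull ℝ _)
    rw [Finset.mem_coe, mem_vertexPoints hm hτ] at hv
    exact hτ.space_eq ▸ τ.vertices_subset_space hv
  · intro q hq
    rw [← hτ.space_eq, Geometry.SimplicialComplex.mem_space_iff] at hq
    obtain ⟨s, hs, hq⟩ := hq
    exact convexHull_mono (Finset.coe_subset.2 (face_subset_vertexPoints hm hτ hs)) hq

lemma affineSpan_triangle {T : Finset (ℝ × ℝ)} (hT : T ∈ triangles τ) :
    affineSpan ℝ (T : Set (ℝ × ℝ)) = ⊤ := by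
  have h := (τ.indep hT.1).affineSpan_eq_top_iff_card_eq_finrank_add_one
  rw [Subtype.range_coe_subtype] at h
  exact h.2 (by simp [hT.2])

lemma interior_triangle_nonempty {T : Finset (ℝ × ℝ)} (hT : T ∈ triangles τ) :
    (interior (convexHull ℝ (T : Set (ℝ × ℝ)))).Nonempty :=
  interior_convexHull_nonempty_iff_affineSpan_eq_top.2 (affineSpan_triangle hT)

/-- The affine coordinate functions of a triangle. -/
lemma exists_coord {T : Finset (ℝ × ℝ)} (hT : T ∈ triangles τ) :
    ∃ f : ℝ × ℝ → ((ℝ × ℝ) →ᵃ[ℝ] ℝ), ∀ u ∈ T, f u u = 1 ∧ ∀ v ∈ T, v ≠ u → f u v = 0 := by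
  classical
  let b : AffineBasis T ℝ (ℝ × ℝ) := ⟨(↑), τ.indep hT.1, by
    rw [Subtype.range_coe_subtype]; exact affineSpan_triangle hT⟩
  refine ⟨fun u => if h : u ∈ T then b.coord ⟨u, h⟩ else 0, fun u hu => ?_⟩
  simp only [dif_pos hu]
  refine ⟨b.coord_apply_eq ⟨u, hu⟩, fun v hv hvu => ?_⟩
  exact b.coord_apply_ne (i := ⟨u, hu⟩) (j := ⟨v, hv⟩) fun h => hvu (congrArg Subtype.val h).symm

lemma IsBarycentric.coord_apply {T : Finset (ℝ × ℝ)} {q u : ℝ × ℝ} {w : ℝ × ℝ → ℝ}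
    (h : IsBarycentric T q w) {f : (ℝ × ℝ) →ᵃ[ℝ] ℝ} (hu : u ∈ T)
    (hf : f u = 1 ∧ ∀ v ∈ T, v ≠ u → f v = 0) : f q = w u := by
  rw [h.affineMap_apply, Finset.sum_eq_single_of_mem u hu fun v hv hvu => by
    rw [hf.2 v hv hvu, mul_zero], hf.1, mul_one]

lemma volume_convexHull_face {s : Finset (ℝ × ℝ)} (hs : s ∈ τ.faces) (h : s.card ≠ 3) :
    MeasureTheory.volume (convexHull ℝ (s : Set (ℝ × ℝ))) = 0 := by
  refine MeasureTheory.measure_mono_null (convexHull_subset_affineSpan _)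
    (MeasureTheory.Measure.addHaar_affineSubspace _ _ fun htop => h ?_)
  have h1 := (τ.indep hs).affineSpan_eq_top_iff_card_eq_finrank_add_one
  rw [Subtype.range_coe_subtype] at h1
  simpa using h1.1 htop

/-- The union of the triangles of `τ`. -/
def triangleUnion (τ : Geometry.SimplicialComplex ℝ (ℝ × ℝ)) : Set (ℝ × ℝ) :=
  ⋃ T ∈ triangles τ, convexHull ℝ (T : Set (ℝ × ℝ))

lemma isClosed_convexHull_finset (T : Finset (ℝ × ℝ)) :
    IsClosed (convexHull ℝ (T : Set (ℝ × ℝ))) :=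
  (T.finite_toSet.isCompact_convexHull (𝕜 := ℝ)).isClosed

lemma isClosed_triangleUnion (hm : 0 < m) (hτ : IsLatticeTriangulation m τ) :
    IsClosed (triangleUnion τ) :=
  (finite_triangles hm hτ).isClosed_biUnion fun T _ => isClosed_convexHull_finset T

/-- Purity is not part of the definition of a simplicial complex. Points outside the triangles lie
in finitely many lower-dimensional faces, which have measure zero, while their complement within the
triangles' union leaves an open remainder of U; an open null set is empty. -/
lemma subset_triangleUnion_of_isOpen (hm : 0 < m) (hτ : IsLatticeTriangulation m τ)
    {U : Set (ℝ × ℝ)} (hU : IsOpen U) (hUm : U ⊆ bigTriangle m) : U ⊆ triangleUnion τ := by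
  have hsub : U \ triangleUnion τ ⊆
      ⋃ s ∈ {s ∈ τ.faces | s.card ≠ 3}, convexHull ℝ (s : Set (ℝ × ℝ)) := by
    rintro q ⟨hq, hqT⟩
    have h := hUm hq
    rw [← hτ.space_eq, Geometry.SimplicialComplex.mem_space_iff] at h
    obtain ⟨s, hs, hqs⟩ := h
    refine Set.mem_biUnion (x := s) ⟨hs, fun hc => hqT ?_⟩ hqs
    exact Set.mem_biUnion (x := s) ⟨hs, hc⟩ hqs
  have hnull : MeasureTheory.volume
      (⋃ s ∈ {s ∈ τ.faces | s.card ≠ 3}, convexHull ℝ (s : Set (ℝ × ℝ))) = 0 := by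
    rw [MeasureTheory.measure_biUnion_null_iff
      ((finite_faces hm hτ).subset fun _ h => h.1).countable]
    exact fun s hs => volume_convexHull_face hs.1 hs.2
  have := (hU.sdiff (isClosed_triangleUnion hm hτ)).eq_empty_of_measure_zero
    (MeasureTheory.measure_mono_null hsub hnull)
  exact Set.sdiff_eq_empty.1 this

lemma exists_triangle_of_mem_interior (hm : 0 < m) (hτ : IsLatticeTriangulation m τ)
    {q : ℝ × ℝ} (hq : q ∈ interior (bigTriangle m)) :
    ∃ T ∈ triangles τ, q ∈ convexHull ℝ (T : Set (ℝ × ℝ)) := by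
  have := subset_triangleUnion_of_isOpen hm hτ isOpen_interior interior_subset hq
  simpa [triangleUnion] using this

/-- Pasting over finitely many closed triangles: on each one the coordinate is affine or zero. -/
lemma continuousOn_bary (hm : 0 < m) (hτ : IsLatticeTriangulation m τ) (v : ℝ × ℝ) :
    ContinuousOn (fun q => bary τ q v) (interior (bigTriangle m)) := by
  have hfin := finite_triangles hm hτ
  have : Finite (triangles τ) := hfin
  have h : ContinuousOn (fun q => bary τ q v)
      (⋃ T : triangles τ, convexHull ℝ ((T : Finset (ℝ × ℝ)) : Set (ℝ × ℝ))) := by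
    refine (locallyFinite_of_finite _).continuousOn_iUnion
      (fun T => isClosed_convexHull_finset T) fun ⟨T, hT⟩ => ?_
    by_cases hv : v ∈ T
    · obtain ⟨f, hf⟩ := exists_coord hT
      refine ((f v).continuous_of_finiteDimensional.continuousOn).congr fun q hq => ?_
      exact ((isBarycentric_bary hT.1 hq).coord_apply hv (hf v hv)).symm
    · refine (continuousOn_const (c := (0 : ℝ))).congr fun q hq => ?_
      exact (isBarycentric_bary hT.1 hq).eq_zero v hv
  refine h.mono fun q hq => ?_
  obtain ⟨T, hT, hqT⟩ := exists_triangle_of_mem_interior hm hτ hq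
  exact Set.mem_iUnion.2 ⟨⟨T, hT⟩, hqT⟩

/-! ### Convexity -/

/-- Prolong the segment from p to an interior point o of T slightly beyond o, staying in T. Then o
lies between p and a point of T, and convexity at o gives the bound at p. -/
lemma le_of_eqOn_triangle {ν : ℝ × ℝ → ℝ} (hν : ConvexOn ℝ (bigTriangle m) ν)
    (hτ : IsLatticeTriangulation m τ) {T : Finset (ℝ × ℝ)}
    (hT : T ∈ triangles τ) {l : (ℝ × ℝ) →ᵃ[ℝ] ℝ}
    (hl : Set.EqOn ν l (convexHull ℝ (T : Set (ℝ × ℝ)))) {p : ℝ × ℝ} (hp : p ∈ bigTriangle m) :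
    l p ≤ ν p := by
  obtain ⟨o, ho⟩ := interior_triangle_nonempty hT
  have hlim : Tendsto (fun r : ℝ => o + r • (o - p)) (𝓝[>] 0) (𝓝 o) := by
    have h1 : Continuous fun r : ℝ => o + r • (o - p) := by fun_prop
    have := h1.tendsto 0
    simp only [zero_smul, add_zero] at this
    exact this.mono_left nhdsWithin_le_nhds
  obtain ⟨r, hr, hr0⟩ :=
    ((hlim.eventually_mem (mem_interior_iff_mem_nhds.1 ho)).and self_mem_nhdsWithin).exists
  have hr0 : 0 < r := hr0
  have ho' := interior_subset ho
  have hab : 1 / (1 + r) + r / (1 + r) = 1 := by field_simp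
  have e : o = (1 / (1 + r)) • (o + r • (o - p)) + (r / (1 + r)) • p := by
    ext <;> simp <;> field_simp <;> ring
  have h1 := hν.2 (convexHull_face_subset hτ hT.1 hr) hp
    (show 0 ≤ 1 / (1 + r) by positivity) (show 0 ≤ r / (1 + r) by positivity) hab
  have h2 := Convex.combo_affine_apply (f := l) (x := o + r • (o - p)) (y := p) hab
  rw [← e] at h1 h2
  rw [hl ho', hl hr, h2] at h1
  simp only [smul_eq_mul] at h1
  exact le_of_mul_le_mul_left (by linarith) (show 0 < r / (1 + r) by positivity)

/-- Equality at v would make ν equal to `l` on the hull C of T and v. A part of C with nonempty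
interior lies outside T and meets another triangle in an open set, so ν would be given by the same
affine function on both triangles. -/
lemma lt_of_notMem_triangle (hm : 0 < m) (hτ : IsLatticeTriangulation m τ) {ν : ℝ × ℝ → ℝ}
    (hν : CertifiesConvexity m τ ν) {T : Finset (ℝ × ℝ)}
    (hT : T ∈ triangles τ) {l : (ℝ × ℝ) →ᵃ[ℝ] ℝ}
    (hl : Set.EqOn ν l (convexHull ℝ (T : Set (ℝ × ℝ)))) {v : ℝ × ℝ} (hv : v ∈ vertexPoints m τ)
    (hvT : v ∉ T) : l v < ν v := by
  rw [mem_vertexPoints hm hτ] at hv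
  have hvm : v ∈ bigTriangle m := hτ.space_eq ▸ τ.vertices_subset_space hv
  refine lt_of_le_of_ne (le_of_eqOn_triangle hν.convexOn hτ hT hl hvm) fun heq => ?_
  have hvT' : v ∉ convexHull ℝ (T : Set (ℝ × ℝ)) := fun h =>
    hvT ((Geometry.SimplicialComplex.vertex_mem_convexHull_iff hv hT.1).1 h)
  set C := convexHull ℝ (insert v (T : Set (ℝ × ℝ))) with hC
  have hTC : convexHull ℝ (T : Set (ℝ × ℝ)) ⊆ C := convexHull_mono (Set.subset_insert _ _)
  have hconv : Convex ℝ {p ∈ bigTriangle m | ν p ≤ l p} := by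
    rintro p ⟨hp, hp'⟩ q ⟨hq, hq'⟩ a b ha hb hab
    refine ⟨hν.convexOn.1 hp hq ha hb hab, ?_⟩
    rw [Convex.combo_affine_apply hab]
    exact (hν.convexOn.2 hp hq ha hb hab).trans (by gcongr)
  have hCsub : C ⊆ {p ∈ bigTriangle m | ν p ≤ l p} := by
    refine convexHull_min ?_ hconv
    rintro p (rfl | hp)
    · exact ⟨hvm, heq.ge⟩
    · have hp := subset_convexHull ℝ _ hp
      exact ⟨convexHull_face_subset hτ hT.1 hp, (hl hp).le⟩
  have hCeq : Set.EqOn ν l C := fun p hp => le_antisymm (hCsub hp).2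
    (le_of_eqOn_triangle hν.convexOn hτ hT hl (hCsub hp).1)
  set U := interior C \ convexHull ℝ (T : Set (ℝ × ℝ)) with hU
  have hUo : IsOpen U := isOpen_interior.sdiff (isClosed_convexHull_finset T)
  -- Points near v on the segment from v to an interior point of T are interior to C and avoid the
  -- closed set T.
  have hUne : U.Nonempty := by
    obtain ⟨o, ho⟩ := interior_triangle_nonempty hT
    have hlim : Tendsto (fun r : ℝ => r • o + (1 - r) • v) (𝓝[>] 0) (𝓝 v) := by
      have h1 : Continuous fun r : ℝ => r • o + (1 - r) • v := by fun_prop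
      have := h1.tendsto 0
      simp only [zero_smul, zero_add, sub_zero, one_smul] at this
      exact this.mono_left nhdsWithin_le_nhds
    obtain ⟨r, ⟨hr, hr0⟩, hr1⟩ := ((hlim.eventually
      ((isClosed_convexHull_finset T).isOpen_compl.mem_nhds hvT')).and
      self_mem_nhdsWithin |>.and (nhdsWithin_le_nhds (Iio_mem_nhds one_pos))).exists
    refine ⟨_, ?_, hr⟩
    exact (convex_convexHull ℝ _).openSegment_interior_self_subset_interior
      (interior_mono hTC ho) (subset_convexHull ℝ _ (Set.mem_insert _ _))
      ⟨r, 1 - r, hr0, sub_pos.2 hr1, by ring, rfl⟩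
  obtain ⟨u, hu⟩ := hUne
  have huT := subset_triangleUnion_of_isOpen hm hτ hUo
    (fun p hp => (hCsub (interior_subset hp.1)).1) hu
  simp only [triangleUnion, Set.mem_iUnion, exists_prop] at huT
  obtain ⟨T', hT', huT'⟩ := huT
  have hne : T ≠ T' := by
    rintro rfl
    exact hu.2 huT'
  obtain ⟨l', hl'⟩ := hν.linear T' hT'
  have hcl : u ∈ closure (interior (convexHull ℝ (T' : Set (ℝ × ℝ)))) := by
    rw [(convex_convexHull ℝ _).closure_interior_eq_closure_of_nonempty_interior
      (interior_triangle_nonempty hT')]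
    exact subset_closure huT'
  have hW := mem_closure_iff.1 hcl U hUo hu
  have hll : l = l' := by
    refine AffineMap.ext_on ((hUo.inter isOpen_interior).affineSpan_eq_top hW) fun p hp => ?_
    rw [← hCeq (interior_subset hp.1.1), hl' (interior_subset hp.2)]
  subst hll
  exact hν.not_linear T hT T' hT' hne ⟨l, fun p hp => hp.elim (fun h => hl h) fun h => hl' h⟩

end Triangulation

/-! ### The Gibbs distribution at low temperature -/

/-- The expectation of the sign under the Gibbs distribution. -/
def gibbsSign (V : Finset (ℝ × ℝ)) (c sg : ℝ × ℝ → ℝ) (w : ℝ × ℝ) : ℝ :=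
  ∑ v ∈ V, sg v * gibbs V c w v

/-- The piecewise linear interpolation of the signs at the vertices of `τ`. -/
def plSign (m : ℕ) (τ : Geometry.SimplicialComplex ℝ (ℝ × ℝ)) (sg : ℝ × ℝ → ℝ) (q : ℝ × ℝ) : ℝ :=
  ∑ v ∈ vertexPoints m τ, sg v * bary τ q v

/-- The exponents of the polynomial `b_t`, for `t = exp (-N)`. -/
def scaledWeight (ν : ℝ × ℝ → ℝ) (N : ℝ) (v : ℝ × ℝ) : ℝ := -(N * ν v)

section LowTemperature

variable {m : ℕ} {τ : Geometry.SimplicialComplex ℝ (ℝ × ℝ)} {ν sg : ℝ × ℝ → ℝ}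
  {T : Finset (ℝ × ℝ)}

lemma exists_gap (hm : 0 < m) (hτ : IsLatticeTriangulation m τ) (hν : CertifiesConvexity m τ ν)
    (hT : T ∈ triangles τ) {l : (ℝ × ℝ) →ᵃ[ℝ] ℝ}
    (hl : Set.EqOn ν l (convexHull ℝ (T : Set (ℝ × ℝ)))) :
    ∃ δ > 0, ∀ v ∈ vertexPoints m τ \ T, δ ≤ ν v - l v := by
  rcases (vertexPoints m τ \ T).eq_empty_or_nonempty with h | h
  · exact ⟨1, one_pos, by simp [h]⟩
  · obtain ⟨v, hv, hmin⟩ := (vertexPoints m τ \ T).exists_min_image (fun v => ν v - l v) h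
    rw [Finset.mem_sdiff] at hv
    exact ⟨_, sub_pos.2 (lt_of_notMem_triangle hm hτ hν hT hl hv.1 hv.2), hmin⟩

/-- At low temperature, the Gibbs distribution is concentrated on the vertices of the triangle
that contains its barycenter. -/
lemma eventually_sum_gibbs_le (hm : 0 < m) (hτ : IsLatticeTriangulation m τ)
    (hν : CertifiesConvexity m τ ν) (hT : T ∈ triangles τ) {ε : ℝ} (hε : 0 < ε) :
    ∀ᶠ N in atTop, ∀ w,
      momentMap (vertexPoints m τ) (scaledWeight ν N) w ∈ convexHull ℝ (T : Set (ℝ × ℝ)) →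
      ∑ v ∈ vertexPoints m τ \ T, gibbs (vertexPoints m τ) (scaledWeight ν N) w v ≤ ε := by
  obtain ⟨l, hl⟩ := hν.linear T hT
  obtain ⟨δ, hδ, hgap⟩ := exists_gap hm hτ hν hT hl
  set V := vertexPoints m τ with hV
  have hVm := convexHull_vertexPoints hm hτ
  have hne : V.Nonempty := nonempty_of_bigTriangle_subset hVm.ge
  filter_upwards [eventually_gt_atTop 0, eventually_ge_atTop (V.card / (ε * δ))] with N hN0 hN w hw
  set c := scaledWeight ν N with hc
  set q := momentMap V c w with hq
  have hTV : T ⊆ V := face_subset_vertexPoints hm hτ hT.1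
  have hβT := isBarycentric_bary hT.1 hw
  have hβ := hβT.mono hTV
  -- The competitor is the barycentric distribution on T, of mean energy N l(q). The excess energy
  -- of the Gibbs distribution is N times the mean of ν - l, so that product is at most the number
  -- of vertices.
  have h1 := sum_mul_sub_sum_gibbs_mul_le (c := c) (w := w) hne (fun v _ => hβ.nonneg v)
    hβ.sum_eq_one hβ.sum_smul
  have e1 : ∑ v ∈ V, bary τ q v * c v = -N * l q := by
    rw [hβ.affineMap_apply l, Finset.mul_sum]
    refine Finset.sum_congr rfl fun v _ => ?_
    by_cases hv : v ∈ T
    · rw [hc, scaledWeight, hl (subset_convexHull ℝ _ hv)]; ring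
    · rw [hβT.eq_zero v hv]; ring
  have e2 : l q = ∑ v ∈ V, gibbs V c w v * l v := by
    rw [hq, momentMap, affineMap_sum_smul (sum_gibbs hne w)]
  have e3 : ∑ v ∈ V, bary τ q v * c v - ∑ v ∈ V, gibbs V c w v * c v =
      N * ∑ v ∈ V, gibbs V c w v * (ν v - l v) := by
    rw [e1, e2, Finset.mul_sum, Finset.mul_sum, ← Finset.sum_sub_distrib]
    exact Finset.sum_congr rfl fun v _ => by rw [hc, scaledWeight]; ring
  have e4 : δ * ∑ v ∈ V \ T, gibbs V c w v ≤ ∑ v ∈ V, gibbs V c w v * (ν v - l v) := by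
    rw [← Finset.sum_sdiff hTV, Finset.sum_eq_zero (s := T) fun v hv => by
      rw [hl (subset_convexHull ℝ _ hv), sub_self, mul_zero], add_zero, Finset.mul_sum]
    refine Finset.sum_le_sum fun v hv => ?_
    rw [mul_comm]
    exact mul_le_mul_of_nonneg_left (hgap v hv) (gibbs_pos hne w v).le
  rw [e3] at h1
  rw [div_le_iff₀ (by positivity)] at hN
  have h2 : N * (δ * ∑ v ∈ V \ T, gibbs V c w v) ≤ N * (ε * δ) :=
    (mul_le_mul_of_nonneg_left e4 hN0.le).trans (h1.trans hN)
  have h3 := le_of_mul_le_mul_left h2 hN0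
  rw [mul_comm ε] at h3
  exact le_of_mul_le_mul_left h3 hδ

/-- On T the interpolated sign is an affine function, whose value at a barycenter is its Gibbs mean.
It agrees with the sign at the vertices of T, so only the other vertices contribute. -/
lemma gibbsSign_sub_plSign (hm : 0 < m) (hτ : IsLatticeTriangulation m τ) (hT : T ∈ triangles τ)
    {f : ℝ × ℝ → ((ℝ × ℝ) →ᵃ[ℝ] ℝ)} (hf : ∀ u ∈ T, f u u = 1 ∧ ∀ v ∈ T, v ≠ u → f u v = 0)
    {c : ℝ × ℝ → ℝ} {w : ℝ × ℝ}
    (hw : momentMap (vertexPoints m τ) c w ∈ convexHull ℝ (T : Set (ℝ × ℝ))) :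
    gibbsSign (vertexPoints m τ) c sg w - plSign m τ sg (momentMap (vertexPoints m τ) c w) =
      ∑ v ∈ vertexPoints m τ \ T,
        gibbs (vertexPoints m τ) c w v * (sg v - ∑ u ∈ T, sg u * f u v) := by
  have hne := nonempty_of_bigTriangle_subset (convexHull_vertexPoints hm hτ).ge
  set V := vertexPoints m τ with hV
  have hTV : T ⊆ V := face_subset_vertexPoints hm hτ hT.1
  have hβ := isBarycentric_bary hT.1 hw
  have e1 : plSign m τ sg (momentMap V c w) =
      ∑ v ∈ V, gibbs V c w v * ∑ u ∈ T, sg u * f u v := by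
    rw [plSign, ← hV, ← Finset.sum_subset hTV fun v _ hv => by rw [hβ.eq_zero v hv, mul_zero]]
    simp_rw [Finset.mul_sum]
    rw [Finset.sum_comm]
    refine Finset.sum_congr rfl fun u hu => ?_
    rw [← hβ.coord_apply hu (hf u hu), momentMap, affineMap_sum_smul (sum_gibbs hne w),
      Finset.mul_sum]
    exact Finset.sum_congr rfl fun v _ => by ring
  rw [e1, gibbsSign, ← Finset.sum_sub_distrib, ← Finset.sum_sdiff hTV,
    Finset.sum_eq_zero (s := T), add_zero]
  · exact Finset.sum_congr rfl fun v _ => by ring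
  · intro v hv
    rw [Finset.sum_eq_single_of_mem v hv fun u hu huv => by
      rw [(hf u hu).2 v hv huv.symm, mul_zero], (hf v hv).1]
    ring

/-- At low temperature, the difference between the expected sign and the piecewise linear sign is
small on every triangle, and has small Lipschitz constant along the rays from its vertices. -/
lemma eventually_abs_gibbsSign_sub_le (hm : 0 < m) (hτ : IsLatticeTriangulation m τ)
    (hν : CertifiesConvexity m τ ν) (hsg : ∀ v, |sg v| ≤ 1) (hT : T ∈ triangles τ) :
    ∀ᶠ N in atTop, ∀ w,
      momentMap (vertexPoints m τ) (scaledWeight ν N) w ∈ convexHull ℝ (T : Set (ℝ × ℝ)) →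
      |gibbsSign (vertexPoints m τ) (scaledWeight ν N) sg w -
        plSign m τ sg (momentMap (vertexPoints m τ) (scaledWeight ν N) w)| ≤ 1 / 20 ∧
      ∀ w', momentMap (vertexPoints m τ) (scaledWeight ν N) w' ∈
          convexHull ℝ (T : Set (ℝ × ℝ)) →
        ∀ a ∈ T, ∀ ρ : ℝ, 0 ≤ ρ → ρ ≤ 3 / 5 →
        3 / 10 ≤ bary τ (momentMap (vertexPoints m τ) (scaledWeight ν N) w) a →
        momentMap (vertexPoints m τ) (scaledWeight ν N) w' =
          momentMap (vertexPoints m τ) (scaledWeight ν N) w +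
            ρ • (a - momentMap (vertexPoints m τ) (scaledWeight ν N) w) →
        |(gibbsSign (vertexPoints m τ) (scaledWeight ν N) sg w' -
          plSign m τ sg (momentMap (vertexPoints m τ) (scaledWeight ν N) w')) -
        (gibbsSign (vertexPoints m τ) (scaledWeight ν N) sg w -
          plSign m τ sg (momentMap (vertexPoints m τ) (scaledWeight ν N) w))| ≤ ρ / 20 := by
  obtain ⟨f, hf⟩ := exists_coord hT
  have hne := nonempty_of_bigTriangle_subset (convexHull_vertexPoints hm hτ).ge
  have hTV : T ⊆ vertexPoints m τ := face_subset_vertexPoints hm hτ hT.1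
  set V := vertexPoints m τ with hV
  obtain ⟨C, hC4, hC, hC'⟩ : ∃ C : ℝ, 4 ≤ C ∧ (∀ u ∈ T, ∀ v ∈ V, |f u v| ≤ C) ∧
      ∀ v ∈ V, |sg v - ∑ u ∈ T, sg u * f u v| ≤ C := by
    have h0 : ∀ v, 0 ≤ ∑ u ∈ T, |f u v| := fun v => Finset.sum_nonneg fun _ _ => abs_nonneg _
    have hle : ∀ v ∈ V, ∑ u ∈ T, |f u v| ≤ ∑ v ∈ V, ∑ u ∈ T, |f u v| := fun v hv =>
      Finset.single_le_sum (f := fun v => ∑ u ∈ T, |f u v|) (fun v _ => h0 v) hv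
    refine ⟨4 + ∑ v ∈ V, ∑ u ∈ T, |f u v|, ?_, fun u hu v hv => ?_, fun v hv => ?_⟩
    · have := Finset.sum_nonneg fun v (_ : v ∈ V) => h0 v
      linarith
    · have := Finset.single_le_sum (f := fun u => |f u v|) (fun _ _ => abs_nonneg _) hu
      linarith [hle v hv]
    · have h1 : |∑ u ∈ T, sg u * f u v| ≤ ∑ u ∈ T, |f u v| := by
        refine (Finset.abs_sum_le_sum_abs _ _).trans (Finset.sum_le_sum fun u _ => ?_)
        rw [abs_mul]
        exact mul_le_of_le_one_left (abs_nonneg _) (hsg u)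
      have := abs_sub (sg v) (∑ u ∈ T, sg u * f u v)
      linarith [hle v hv, hsg v]
  -- Chosen so that √(2ε) = 1/(250C). With J ≤ (25ρ/2)² below, the variation is at most C ·
  -- (25ρ/2)/(250C) = ρ/20.
  have hε : 0 < (1 / (250 * C)) ^ 2 / 2 := by positivity
  filter_upwards [eventually_sum_gibbs_le hm hτ hν hT hε] with N hN w hw
  rw [← hV] at hN
  set c := scaledWeight ν N with hc
  set ε := (1 / (250 * C)) ^ 2 / 2 with hεd
  have hεC : ε * C ≤ 1 / 20 := by
    have : ε * C = 1 / (125000 * C) := by rw [hεd]; field_simp; norm_num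
    rw [this, div_le_div_iff₀ (by positivity) (by norm_num)]
    linarith
  have hsum := hN w hw
  have habs : ∀ x : ℝ × ℝ → ℝ, ∀ y : ℝ × ℝ → ℝ, (∀ v ∈ V, |y v| ≤ C) →
      |∑ v ∈ V \ T, x v * y v| ≤ (∑ v ∈ V \ T, |x v|) * C := by
    intro x y hy
    rw [Finset.sum_mul]
    refine (Finset.abs_sum_le_sum_abs _ _).trans (Finset.sum_le_sum fun v hv => ?_)
    rw [abs_mul]
    exact mul_le_mul_of_nonneg_left (hy v (Finset.mem_sdiff.1 hv).1) (abs_nonneg _)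
  have hgabs : ∀ w, ∑ v ∈ V \ T, |gibbs V c w v| = ∑ v ∈ V \ T, gibbs V c w v := fun w =>
    Finset.sum_congr rfl fun v _ => abs_of_pos (gibbs_pos hne w v)
  have hsmall : ∀ y : ℝ × ℝ → ℝ, (∀ v ∈ V, |y v| ≤ C) →
      |∑ v ∈ V \ T, gibbs V c w v * y v| ≤ 1 / 20 := fun y hy => by
    refine (habs _ y hy).trans ?_
    rw [hgabs]
    exact (mul_le_mul_of_nonneg_right hsum (by linarith)).trans hεC
  refine ⟨?_, fun w' hw' a ha ρ hρ hρ' hβa hρw => ?_⟩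
  · rw [gibbsSign_sub_plSign hm hτ hT hf hw]
    exact hsmall _ hC'
  · have hκ : (1 : ℝ) / 5 ≤ gibbs V c w a := by
      have e : bary τ (momentMap V c w) a =
          gibbs V c w a + ∑ v ∈ V \ T, gibbs V c w v * f a v := by
        rw [← (isBarycentric_bary hT.1 hw).coord_apply ha (hf a ha)]
        conv_lhs => rw [momentMap]
        rw [affineMap_sum_smul (sum_gibbs hne w),
          ← Finset.sum_sdiff hTV, add_comm, Finset.sum_eq_single_of_mem a ha fun v hv hva => by
            rw [(hf a ha).2 v hv hva, mul_zero], (hf a ha).1, mul_one]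
      have := (abs_le.1 (hsmall (f a) (hC a ha))).2
      rw [e] at hβa
      linarith
    have hJ := dot_momentMap_sub_le hne (hTV ha) hρ hρ' (by norm_num) hκ hρw
    have hS := sum_abs_gibbs_sub_sq_le (c := c) hne w w' Finset.sdiff_subset hsum (hN w' hw')
    have hS' : ∑ v ∈ V \ T, |gibbs V c w' v - gibbs V c w v| ≤ 1 / (250 * C) * (25 / 2 * ρ) := by
      refine le_of_sq_le_sq (hS.trans ?_) (by positivity)
      calc _ ≤ 2 * ε * (5 * ρ / (2 * (1 / 5))) ^ 2 := by gcongr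
        _ = _ := by rw [hεd]; ring
    have e : (gibbsSign V c sg w' - plSign m τ sg (momentMap V c w')) -
        (gibbsSign V c sg w - plSign m τ sg (momentMap V c w)) =
        ∑ v ∈ V \ T, (gibbs V c w' v - gibbs V c w v) * (sg v - ∑ u ∈ T, sg u * f u v) := by
      rw [gibbsSign_sub_plSign hm hτ hT hf hw, gibbsSign_sub_plSign hm hτ hT hf hw',
        ← Finset.sum_sub_distrib]
      exact Finset.sum_congr rfl fun v _ => by ring
    rw [e]
    refine (habs _ _ hC').trans ?_
    calc _ ≤ 1 / (250 * C) * (25 / 2 * ρ) * C := by gcongr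
      _ = ρ / 20 := by field_simp; ring

end LowTemperature

/-! ### Leaves joining the positive to the negative vertices -/

/-- The barycentric coordinates of the point of mean sign `2 * u - 1` on the leaf through `q`. -/
def leafWeight (m : ℕ) (τ : Geometry.SimplicialComplex ℝ (ℝ × ℝ)) (sg : ℝ × ℝ → ℝ) (q : ℝ × ℝ)
    (u : ℝ) (v : ℝ × ℝ) : ℝ :=
  (u * ((1 + sg v) / (1 + plSign m τ sg q)) + (1 - u) * ((1 - sg v) / (1 - plSign m τ sg q))) *
    bary τ q v

/-- The point of mean sign `2 * u - 1` on the leaf through `q`. -/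
def leafPoint (m : ℕ) (τ : Geometry.SimplicialComplex ℝ (ℝ × ℝ)) (sg : ℝ × ℝ → ℝ) (q : ℝ × ℝ)
    (u : ℝ) : ℝ × ℝ :=
  ∑ v ∈ vertexPoints m τ, leafWeight m τ sg q u v • v

/-- The distances x, y and m - x - y are affine and nonnegative at the vertices, so they are
monotone in the weights. -/
lemma deepPart_of_le_mul {m : ℕ} (hm : 0 < m) {V : Finset (ℝ × ℝ)}
    (hV : (V : Set (ℝ × ℝ)) ⊆ bigTriangle m) {q q' : ℝ × ℝ} {w w' : ℝ × ℝ → ℝ}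
    (h : IsBarycentric V q w) (h' : IsBarycentric V q' w') {K δ : ℝ} (hK : 0 < K)
    (hle : ∀ v ∈ V, w v ≤ K * w' v) (hq : q ∈ deepPart m δ) : q' ∈ deepPart m (δ / K) := by
  rw [bigTriangle_eq hm] at hV
  have key : ∀ d : (ℝ × ℝ) →ᵃ[ℝ] ℝ, (∀ v ∈ V, 0 ≤ d v) → δ ≤ d q → δ / K ≤ d q' := by
    intro d hd hdq
    rw [div_le_iff₀' hK]
    refine hdq.trans ?_
    rw [h.affineMap_apply, h'.affineMap_apply, Finset.mul_sum]
    refine Finset.sum_le_sum fun v hv => ?_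
    rw [← mul_assoc]
    exact mul_le_mul_of_nonneg_right (hle v hv) (hd v hv)
  obtain ⟨h1, h2, h3⟩ := hq
  refine ⟨key (LinearMap.fst ℝ ℝ ℝ).toAffineMap (fun v hv => (hV hv).1) h1,
    key (LinearMap.snd ℝ ℝ ℝ).toAffineMap (fun v hv => (hV hv).2.1) h2, ?_⟩
  have := key (AffineMap.const ℝ (ℝ × ℝ) (m : ℝ) -
    ((LinearMap.fst ℝ ℝ ℝ).toAffineMap + (LinearMap.snd ℝ ℝ ℝ).toAffineMap))
    (fun v hv => by simpa using (hV hv).2.2) (by simp; linarith)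
  simp at this
  linarith

section Leaf

variable {m : ℕ} {τ : Geometry.SimplicialComplex ℝ (ℝ × ℝ)} {sg : ℝ × ℝ → ℝ}
  {T : Finset (ℝ × ℝ)} {q : ℝ × ℝ}

lemma IsBarycentric.plSign_eq (hm : 0 < m) (hτ : IsLatticeTriangulation m τ)
    (hT : T ∈ triangles τ) {w : ℝ × ℝ → ℝ} (h : IsBarycentric T q w) :
    plSign m τ sg q = ∑ v ∈ T, sg v * w v := by
  rw [plSign, bary_eq hT.1 h, Finset.sum_subset (face_subset_vertexPoints hm hτ hT.1)]
  intro v _ hv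
  rw [h.eq_zero v hv, mul_zero]

lemma one_add_pos_and_one_sub_pos_of_abs_lt {x r : ℝ} (h : |x| < r) (hr : r ≤ 1) : 0 < 1 + x ∧ 0 < 1 - x := by
  rw [abs_lt] at h
  constructor <;> linarith

/-- The leaf weights mix, in proportions u and 1 - u, the barycentric coordinates conditioned on
positive and on negative sign. They vanish wherever the original coordinates do, so a leaf stays in
every triangle containing q. -/
lemma isBarycentric_leafPoint (hm : 0 < m) (hτ : IsLatticeTriangulation m τ)
    (hsg : ∀ v, sg v = 1 ∨ sg v = -1) (hT : T ∈ triangles τ)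
    (hq : q ∈ convexHull ℝ (T : Set (ℝ × ℝ))) (hg : |plSign m τ sg q| < 1) {u : ℝ} (h0 : 0 ≤ u)
    (h1 : u ≤ 1) : IsBarycentric T (leafPoint m τ sg q u) (leafWeight m τ sg q u) := by
  have hβ := isBarycentric_bary hT.1 hq
  obtain ⟨hp, hn⟩ := one_add_pos_and_one_sub_pos_of_abs_lt hg le_rfl
  have hzero : ∀ v, v ∉ T → leafWeight m τ sg q u v = 0 := fun v hv => by
    rw [leafWeight, hβ.eq_zero v hv, mul_zero]
  refine ⟨fun v => ?_, hzero, ?_, ?_⟩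
  · refine mul_nonneg (add_nonneg (mul_nonneg h0 (div_nonneg ?_ hp.le))
      (mul_nonneg (sub_nonneg.2 h1) (div_nonneg ?_ hn.le))) (hβ.nonneg v) <;>
    rcases hsg v with h | h <;> rw [h] <;> norm_num
  · have e : ∀ v ∈ T, leafWeight m τ sg q u v =
        (u / (1 + plSign m τ sg q) + (1 - u) / (1 - plSign m τ sg q)) * bary τ q v +
        (u / (1 + plSign m τ sg q) - (1 - u) / (1 - plSign m τ sg q)) * (sg v * bary τ q v) :=
      fun v _ => by rw [leafWeight]; ring
    rw [Finset.sum_congr rfl e, Finset.sum_add_distrib, ← Finset.mul_sum, ← Finset.mul_sum,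
      hβ.sum_eq_one, ← hβ.plSign_eq hm hτ hT]
    field_simp
    ring
  · rw [leafPoint, Finset.sum_subset (face_subset_vertexPoints hm hτ hT.1)]
    intro v _ hv
    rw [hzero v hv, zero_smul]

lemma bary_leafPoint (hm : 0 < m) (hτ : IsLatticeTriangulation m τ)
    (hsg : ∀ v, sg v = 1 ∨ sg v = -1) (hT : T ∈ triangles τ)
    (hq : q ∈ convexHull ℝ (T : Set (ℝ × ℝ))) (hg : |plSign m τ sg q| < 1) {u : ℝ} (h0 : 0 ≤ u)
    (h1 : u ≤ 1) : bary τ (leafPoint m τ sg q u) = leafWeight m τ sg q u :=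
  bary_eq hT.1 (isBarycentric_leafPoint hm hτ hsg hT hq hg h0 h1)

lemma plSign_leafPoint (hm : 0 < m) (hτ : IsLatticeTriangulation m τ)
    (hsg : ∀ v, sg v = 1 ∨ sg v = -1) (hT : T ∈ triangles τ)
    (hq : q ∈ convexHull ℝ (T : Set (ℝ × ℝ))) (hg : |plSign m τ sg q| < 1) {u : ℝ} (h0 : 0 ≤ u)
    (h1 : u ≤ 1) : plSign m τ sg (leafPoint m τ sg q u) = 2 * u - 1 := by
  have hβ := isBarycentric_bary hT.1 hq
  obtain ⟨hp, hn⟩ := one_add_pos_and_one_sub_pos_of_abs_lt hg le_rfl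
  rw [(isBarycentric_leafPoint hm hτ hsg hT hq hg h0 h1).plSign_eq hm hτ hT]
  have e : ∀ v ∈ T, sg v * leafWeight m τ sg q u v =
      (u / (1 + plSign m τ sg q) - (1 - u) / (1 - plSign m τ sg q)) * bary τ q v +
      (u / (1 + plSign m τ sg q) + (1 - u) / (1 - plSign m τ sg q)) * (sg v * bary τ q v) :=
    fun v _ => by rw [leafWeight]; rcases hsg v with h | h <;> rw [h] <;> ring
  rw [Finset.sum_congr rfl e, Finset.sum_add_distrib, ← Finset.mul_sum, ← Finset.mul_sum,
    hβ.sum_eq_one, ← hβ.plSign_eq hm hτ hT]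
  field_simp
  ring

/-- Sliding changes only the total mass of each sign, not the two conditional distributions, so the
leaf through a point of a leaf is the same leaf. Both signs must keep positive mass, hence 0 < u <
1. -/
lemma leafPoint_leafPoint (hm : 0 < m) (hτ : IsLatticeTriangulation m τ)
    (hsg : ∀ v, sg v = 1 ∨ sg v = -1) (hT : T ∈ triangles τ)
    (hq : q ∈ convexHull ℝ (T : Set (ℝ × ℝ))) (hg : |plSign m τ sg q| < 1) {u : ℝ} (h0 : 0 < u)
    (h1 : u < 1) (u' : ℝ) :
    leafPoint m τ sg (leafPoint m τ sg q u) u' = leafPoint m τ sg q u' := by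
  obtain ⟨hp, hn⟩ := one_add_pos_and_one_sub_pos_of_abs_lt hg le_rfl
  have h1' : 0 < 1 - u := sub_pos.2 h1
  refine Finset.sum_congr rfl fun v _ => ?_
  congr 1
  rw [leafWeight, bary_leafPoint hm hτ hsg hT hq hg h0.le h1.le,
    plSign_leafPoint hm hτ hsg hT hq hg h0.le h1.le, leafWeight, leafWeight]
  have e1 : 1 + (2 * u - 1) = 2 * u := by ring
  have e2 : 1 - (2 * u - 1) = 2 * (1 - u) := by ring
  rw [e1, e2]
  rcases hsg v with h | h <;> rw [h] <;> field_simp <;> ring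

lemma leafPoint_self (hm : 0 < m) (hτ : IsLatticeTriangulation m τ) (hT : T ∈ triangles τ)
    (hq : q ∈ convexHull ℝ (T : Set (ℝ × ℝ))) (hg : |plSign m τ sg q| < 1) :
    leafPoint m τ sg q ((1 + plSign m τ sg q) / 2) = q := by
  obtain ⟨hp, hn⟩ := one_add_pos_and_one_sub_pos_of_abs_lt hg le_rfl
  have hβ := (isBarycentric_bary hT.1 hq).mono (face_subset_vertexPoints hm hτ hT.1)
  conv_rhs => rw [← hβ.sum_smul]
  refine Finset.sum_congr rfl fun v _ => ?_
  congr 1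
  rw [leafWeight]
  have e2 : 1 - (1 + plSign m τ sg q) / 2 = (1 - plSign m τ sg q) / 2 := by ring
  rw [e2]
  field_simp
  ring

lemma leafPoint_eq (u : ℝ) :
    leafPoint m τ sg q u = u • leafPoint m τ sg q 1 + (1 - u) • leafPoint m τ sg q 0 := by
  simp only [leafPoint, Finset.smul_sum, smul_smul, ← Finset.sum_add_distrib, ← add_smul]
  refine Finset.sum_congr rfl fun v _ => ?_
  congr 1
  simp only [leafWeight]
  ring

/-- In a triangle with vertices of both signs, one vertex is alone with its sign. -/
lemma exists_lone_vertex (hm : 0 < m) (hτ : IsLatticeTriangulation m τ)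
    (hsg : ∀ v, sg v = 1 ∨ sg v = -1) (hT : T ∈ triangles τ)
    (hq : q ∈ convexHull ℝ (T : Set (ℝ × ℝ))) (hg : |plSign m τ sg q| < 1) :
    ∃ a ∈ T, ∀ v ∈ T, v ≠ a → sg v = - sg a := by
  classical
  have hβ := isBarycentric_bary hT.1 hq
  rw [hβ.plSign_eq hm hτ hT] at hg
  have hs := hβ.sum_eq_one
  obtain ⟨a, b, c, hab, hac, hbc, rfl⟩ := Finset.card_eq_three.1 hT.2
  rw [Finset.sum_insert (by simp [hab, hac]), Finset.sum_pair hbc] at hg hs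
  rcases hsg a with ha | ha <;> rcases hsg b with hb | hb <;> rcases hsg c with hc | hc
  · rw [ha, hb, hc, one_mul, one_mul, one_mul, hs, abs_one] at hg
    exact absurd hg (lt_irrefl _)
  · exact ⟨c, by simp, by simp +contextual [ha, hb, hc]⟩
  · exact ⟨b, by simp, by simp +contextual [ha, hb, hc]⟩
  · exact ⟨a, by simp, by simp +contextual [ha, hb, hc]⟩
  · exact ⟨a, by simp, by simp +contextual [ha, hb, hc]⟩
  · exact ⟨b, by simp, by simp +contextual [ha, hb, hc]⟩
  · exact ⟨c, by simp, by simp +contextual [ha, hb, hc]⟩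
  · have : -1 * bary τ q a + (-1 * bary τ q b + -1 * bary τ q c) = -1 := by linarith
    rw [ha, hb, hc, this, abs_neg, abs_one] at hg
    exact absurd hg (lt_irrefl _)

lemma plSign_eq_of_lone (hm : 0 < m) (hτ : IsLatticeTriangulation m τ) (hT : T ∈ triangles τ)
    {w : ℝ × ℝ → ℝ} (h : IsBarycentric T q w) {a : ℝ × ℝ} (ha : a ∈ T)
    (hlone : ∀ v ∈ T, v ≠ a → sg v = - sg a) :
    plSign m τ sg q = sg a * (2 * w a - 1) := by
  classical
  have h1 := h.sum_eq_one
  rw [h.plSign_eq hm hτ hT]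
  rw [← Finset.add_sum_erase _ _ ha] at h1 ⊢
  have e : ∑ v ∈ T.erase a, sg v * w v = - sg a * ∑ v ∈ T.erase a, w v := by
    rw [Finset.mul_sum]
    refine Finset.sum_congr rfl fun v hv => ?_
    rw [hlone v (Finset.mem_of_mem_erase hv) (Finset.ne_of_mem_erase hv)]
  rw [e]
  have : ∑ v ∈ T.erase a, w v = 1 - w a := by linarith
  rw [this]
  ring

/-- The leaves in a triangle are segments ending at the lone vertex. -/
lemma leafPoint_eq_lone (hm : 0 < m) (hτ : IsLatticeTriangulation m τ)
    (hsg : ∀ v, sg v = 1 ∨ sg v = -1) (hT : T ∈ triangles τ)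
    (hq : q ∈ convexHull ℝ (T : Set (ℝ × ℝ))) (hg : |plSign m τ sg q| < 1) {a : ℝ × ℝ}
    (ha : a ∈ T) (hlone : ∀ v ∈ T, v ≠ a → sg v = - sg a) :
    leafPoint m τ sg q ((1 + sg a) / 2) = a := by
  have hu : 0 ≤ (1 + sg a) / 2 ∧ (1 + sg a) / 2 ≤ 1 := by
    rcases hsg a with h | h <;> rw [h] <;> norm_num
  have hb := isBarycentric_leafPoint hm hτ hsg hT hq hg hu.1 hu.2
  have hs := plSign_leafPoint hm hτ hsg hT hq hg hu.1 hu.2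
  rw [plSign_eq_of_lone hm hτ hT hb ha hlone] at hs
  have hwa : leafWeight m τ sg q ((1 + sg a) / 2) a = 1 := by
    rcases hsg a with h | h <;> rw [h] at hs ⊢ <;> linarith
  have h1 := hb.sum_eq_one
  classical
  rw [← Finset.add_sum_erase _ _ ha, hwa] at h1
  have h0 : ∀ v ∈ T.erase a, leafWeight m τ sg q ((1 + sg a) / 2) v = 0 :=
    (Finset.sum_eq_zero_iff_of_nonneg fun v _ => hb.nonneg v).1 (by linarith)
  have h2 := hb.sum_smul
  rw [← Finset.add_sum_erase _ _ ha, hwa, one_smul, Finset.sum_eq_zero fun v hv => by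
    rw [h0 v hv, zero_smul], add_zero] at h2
  exact h2.symm

/-- If `E` has small variation along rays from the vertices of the triangles, then it has small
variation along leaves. -/
lemma abs_sub_leafPoint_le (hm : 0 < m) (hτ : IsLatticeTriangulation m τ)
    (hsg : ∀ v, sg v = 1 ∨ sg v = -1) {E : ℝ × ℝ → ℝ} (hT : T ∈ triangles τ)
    (hq : q ∈ convexHull ℝ (T : Set (ℝ × ℝ))) (hg : |plSign m τ sg q| < 1) {u u' : ℝ}
    (hu : 3 / 10 ≤ u) (huu' : u ≤ u') (hu' : u' ≤ 7 / 10)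
    (hE : ∀ x y, (x = leafPoint m τ sg q u ∨ x = leafPoint m τ sg q u') →
      (y = leafPoint m τ sg q u ∨ y = leafPoint m τ sg q u') →
      ∀ a ∈ T, ∀ ρ : ℝ, 0 ≤ ρ → ρ ≤ 3 / 5 → 3 / 10 ≤ bary τ x a →
      y = x + ρ • (a - x) → |E y - E x| ≤ ρ / 20) :
    |E (leafPoint m τ sg q u') - E (leafPoint m τ sg q u)| ≤ (u' - u) / 6 := by
  obtain ⟨a, ha, hlone⟩ := exists_lone_vertex hm hτ hsg hT hq hg
  have hlp := leafPoint_eq_lone hm hτ hsg hT hq hg ha hlone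
  have hbary : ∀ s, 3 / 10 ≤ s → s ≤ 7 / 10 →
      2 * s - 1 = sg a * (2 * bary τ (leafPoint m τ sg q s) a - 1) := by
    intro s hs hs'
    rw [bary_leafPoint hm hτ hsg hT hq hg (by linarith) (by linarith),
      ← plSign_eq_of_lone hm hτ hT (isBarycentric_leafPoint hm hτ hsg hT hq hg (by linarith)
        (by linarith)) ha hlone,
      plSign_leafPoint hm hτ hsg hT hq hg (by linarith) (by linarith)]
  have hb := hbary u hu (by linarith)
  have hb' := hbary u' (by linarith) hu'
  -- The move is always made towards the lone vertex: from u to u' if it is positive, from u' to u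
  -- if negative. Its coordinate at the start is u or 1 - u', at least 3/10; as 1 - u and u' are
  -- also at least 3/10, ρ/20 is at most (u' - u)/6.
  rcases hsg a with h | h
  · rw [h] at hlp hb hb'
    have h1u : 0 < 1 - u := by linarith
    refine (hE _ _ (Or.inl rfl) (Or.inr rfl) a ha ((u' - u) / (1 - u))
      (div_nonneg (by linarith) h1u.le) ?_ (by linarith) ?_).trans ?_
    · rw [div_le_iff₀ h1u]; linarith
    · rw [leafPoint_eq u', leafPoint_eq u]
      norm_num at hlp
      rw [hlp]
      generalize leafPoint m τ sg q 0 = z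
      ext <;> simp <;> field_simp <;> ring
    · rw [div_div, div_le_div_iff₀ (by positivity) (by norm_num)]
      nlinarith
  · rw [h] at hlp hb hb'
    have h1u : 0 < u' := by linarith
    rw [abs_sub_comm]
    refine (hE _ _ (Or.inr rfl) (Or.inl rfl) a ha ((u' - u) / u')
      (div_nonneg (by linarith) h1u.le) ?_ (by linarith) ?_).trans ?_
    · rw [div_le_iff₀ h1u]; linarith
    · rw [leafPoint_eq u', leafPoint_eq u]
      norm_num at hlp
      rw [hlp]
      generalize leafPoint m τ sg q 1 = z
      ext <;> simp <;> field_simp <;> ring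
    · rw [div_div, div_le_div_iff₀ (by positivity) (by norm_num)]
      nlinarith

end Leaf

/-! ### Straightening the zero set along the leaves -/

/-- A cutoff function: `1` on `[-1/10, 1/10]` and `0` outside `[-1/5, 1/5]`. -/
def cutoff (x : ℝ) : ℝ := max 0 (min 1 (2 - 10 * |x|))

lemma cutoff_nonneg (x : ℝ) : 0 ≤ cutoff x := le_max_left _ _

lemma cutoff_le_one (x : ℝ) : cutoff x ≤ 1 := max_le zero_le_one (min_le_left _ _)

lemma cutoff_eq_one {x : ℝ} (h : |x| ≤ 1 / 10) : cutoff x = 1 := by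
  rw [cutoff, min_eq_left (by linarith), max_eq_right zero_le_one]

lemma cutoff_eq_zero {x : ℝ} (h : 1 / 5 ≤ |x|) : cutoff x = 0 := by
  rw [cutoff, max_eq_left]
  exact (min_le_right _ _).trans (by linarith)

lemma continuous_cutoff : Continuous cutoff := by
  unfold cutoff
  fun_prop

lemma abs_cutoff_sub_le (x y : ℝ) : |cutoff x - cutoff y| ≤ 10 * |x - y| := by
  unfold cutoff
  rw [max_comm 0, max_comm 0]
  refine (abs_max_sub_max_le_abs _ _ _).trans ?_
  rw [min_comm 1, min_comm 1]
  refine (abs_min_sub_min_le_max _ _ _ _).trans ?_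
  rw [sub_self, abs_zero]
  refine max_le ?_ (by positivity)
  have : 2 - 10 * |x| - (2 - 10 * |y|) = -(10 * (|x| - |y|)) := by ring
  rw [this, abs_neg, abs_mul, abs_of_pos (by norm_num : (0 : ℝ) < 10)]
  exact mul_le_mul_of_nonneg_left (abs_abs_sub_abs_le_abs_sub x y) (by norm_num)

/-- A perturbation of the piecewise linear sign that is small, and whose variation along the rays
from the vertices of each triangle is small. -/
structure IsSmallPerturbation (m : ℕ) (τ : Geometry.SimplicialComplex ℝ (ℝ × ℝ))
    (E : ℝ × ℝ → ℝ) : Prop where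
  continuousOn : ContinuousOn E (interior (bigTriangle m))
  abs_le : ∀ q ∈ interior (bigTriangle m), |E q| ≤ 1 / 20
  abs_sub_le : ∀ T ∈ triangles τ, ∀ x ∈ interior (bigTriangle m), ∀ y ∈ interior (bigTriangle m),
    x ∈ convexHull ℝ (T : Set (ℝ × ℝ)) → y ∈ convexHull ℝ (T : Set (ℝ × ℝ)) →
    ∀ a ∈ T, ∀ ρ : ℝ, 0 ≤ ρ → ρ ≤ 3 / 5 → 3 / 10 ≤ bary τ x a →
    y = x + ρ • (a - x) → |E y - E x| ≤ ρ / 20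

/-- The piecewise linear sign, perturbed by `E` near its zero set. -/
def perturbedSign (m : ℕ) (τ : Geometry.SimplicialComplex ℝ (ℝ × ℝ)) (sg E : ℝ × ℝ → ℝ)
    (q : ℝ × ℝ) : ℝ :=
  plSign m τ sg q + cutoff (plSign m τ sg q) * E q

/-- The map that moves every point along its leaf so that the piecewise linear sign of the image is
the perturbed sign of the point. -/
def straighten (m : ℕ) (τ : Geometry.SimplicialComplex ℝ (ℝ × ℝ)) (sg E : ℝ × ℝ → ℝ)
    (q : ℝ × ℝ) : ℝ × ℝ :=
  if |plSign m τ sg q| < 2 / 5 then leafPoint m τ sg q ((1 + perturbedSign m τ sg E q) / 2) else q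

section Straighten

variable {m : ℕ} {τ : Geometry.SimplicialComplex ℝ (ℝ × ℝ)} {sg E : ℝ × ℝ → ℝ} {q : ℝ × ℝ}

lemma perturbedSign_eq (h : 1 / 5 ≤ |plSign m τ sg q|) :
    perturbedSign m τ sg E q = plSign m τ sg q := by
  rw [perturbedSign, cutoff_eq_zero h, zero_mul, add_zero]

lemma abs_perturbedSign_sub_le (hE : IsSmallPerturbation m τ E)
    (hq : q ∈ interior (bigTriangle m)) :
    |perturbedSign m τ sg E q - plSign m τ sg q| ≤ 1 / 20 := by
  rw [perturbedSign, add_sub_cancel_left, abs_mul, abs_of_nonneg (cutoff_nonneg _)]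
  exact (mul_le_of_le_one_left (abs_nonneg _) (cutoff_le_one _)).trans (hE.abs_le q hq)

lemma abs_perturbedSign_lt_iff (hE : IsSmallPerturbation m τ E)
    (hq : q ∈ interior (bigTriangle m)) :
    |perturbedSign m τ sg E q| < 2 / 5 ↔ |plSign m τ sg q| < 2 / 5 := by
  by_cases h : 1 / 5 ≤ |plSign m τ sg q|
  · rw [perturbedSign_eq h]
  · push Not at h
    have h1 := abs_perturbedSign_sub_le (sg := sg) hE hq
    have h2 := abs_sub_abs_le_abs_sub (perturbedSign m τ sg E q) (plSign m τ sg q)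
    constructor <;> intro <;> linarith

/-- Since |E| ≤ 1/20, neither expression vanishes where the interpolated sign exceeds 1/10 in
absolute value; elsewhere the cutoff is 1. -/
lemma perturbedSign_eq_zero_iff (hE : IsSmallPerturbation m τ E)
    (hq : q ∈ interior (bigTriangle m)) :
    perturbedSign m τ sg E q = 0 ↔ plSign m τ sg q + E q = 0 := by
  by_cases h : |plSign m τ sg q| ≤ 1 / 10
  · rw [perturbedSign, cutoff_eq_one h, one_mul]
  · push Not at h
    have h1 := hE.abs_le q hq
    have h2 := abs_perturbedSign_sub_le (sg := sg) hE hq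
    constructor <;> intro h0 <;> exfalso
    · rw [h0, zero_sub, abs_neg] at h2
      linarith
    · rw [eq_neg_of_add_eq_zero_left h0, abs_neg] at h
      linarith

lemma continuousOn_plSign (hm : 0 < m) (hτ : IsLatticeTriangulation m τ) :
    ContinuousOn (plSign m τ sg) (interior (bigTriangle m)) :=
  continuousOn_finsetSum _ fun v _ => continuousOn_const.mul (continuousOn_bary hm hτ v)

lemma continuousOn_perturbedSign (hm : 0 < m) (hτ : IsLatticeTriangulation m τ)
    (hE : IsSmallPerturbation m τ E) :
    ContinuousOn (perturbedSign m τ sg E) (interior (bigTriangle m)) := by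
  have h := continuousOn_plSign (sg := sg) hm hτ
  exact h.add ((continuous_cutoff.comp_continuousOn h).mul hE.continuousOn)

/-- The two branches of `straighten` agree on the overlap 1/5 ≤ |sign| < 2/5. This gives continuity,
and keeps the leaf formula away from |sign| = 1, where its denominators vanish. -/
lemma straighten_of_le (h : 1 / 5 ≤ |plSign m τ sg q|) (hm : 0 < m)
    (hτ : IsLatticeTriangulation m τ) (hq : q ∈ interior (bigTriangle m)) :
    straighten m τ sg E q = q := by
  obtain ⟨T, hT, hqT⟩ := exists_triangle_of_mem_interior hm hτ hq
  rw [straighten]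
  split_ifs with h'
  · rw [perturbedSign_eq h]
    exact leafPoint_self hm hτ hT hqT (h'.trans (by norm_num))
  · rfl

lemma half_one_add_mem_of_abs_lt {x : ℝ} (h : |x| < 2 / 5) :
    3 / 10 < (1 + x) / 2 ∧ (1 + x) / 2 < 7 / 10 := by
  rw [abs_lt] at h
  constructor <;> linarith

lemma vertexPoints_subset (hm : 0 < m) (hτ : IsLatticeTriangulation m τ) :
    (vertexPoints m τ : Set (ℝ × ℝ)) ⊆ bigTriangle m := by
  rw [← convexHull_vertexPoints hm hτ]
  exact subset_convexHull _ _

lemma isBarycentric_bary_interior (hm : 0 < m) (hτ : IsLatticeTriangulation m τ)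
    (hq : q ∈ interior (bigTriangle m)) : IsBarycentric (vertexPoints m τ) q (bary τ q) := by
  obtain ⟨T, hT, hqT⟩ := exists_triangle_of_mem_interior hm hτ hq
  exact (isBarycentric_bary hT.1 hqT).mono (face_subset_vertexPoints hm hτ hT.1)

/-- With `leafWeight_le`, this says that sliding changes barycentric coordinates by factors of at
most 4 either way. Depth is then comparable before and after, which keeps points in the interior and
makes straightening proper. -/
lemma le_leafWeight (hsg : ∀ v, sg v = 1 ∨ sg v = -1) {v : ℝ × ℝ} (hβ : 0 ≤ bary τ q v)
    (hg : |plSign m τ sg q| < 1) {u : ℝ} (hu : 1 / 4 ≤ u) (hu' : u ≤ 3 / 4) :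
    bary τ q v ≤ 4 * leafWeight m τ sg q u v := by
  obtain ⟨hp, hn⟩ := one_add_pos_and_one_sub_pos_of_abs_lt hg le_rfl
  rw [leafWeight, ← mul_assoc]
  refine le_mul_of_one_le_left hβ ?_
  rcases hsg v with h | h <;> rw [h]
  · have : 4 * (u * ((1 + 1) / (1 + plSign m τ sg q)) + (1 - u) *
        ((1 - 1) / (1 - plSign m τ sg q))) = 8 * u / (1 + plSign m τ sg q) := by ring
    rw [this, one_le_div hp]
    linarith
  · have : 4 * (u * ((1 + -1) / (1 + plSign m τ sg q)) + (1 - u) *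
        ((1 - -1) / (1 - plSign m τ sg q))) = 8 * (1 - u) / (1 - plSign m τ sg q) := by ring
    rw [this, one_le_div hn]
    linarith

lemma leafWeight_le (hsg : ∀ v, sg v = 1 ∨ sg v = -1) {v : ℝ × ℝ} (hβ : 0 ≤ bary τ q v)
    (hg : |plSign m τ sg q| < 2 / 5) {u : ℝ} (hu : 0 ≤ u) (hu' : u ≤ 1) :
    leafWeight m τ sg q u v ≤ 4 * bary τ q v := by
  obtain ⟨hp, hn⟩ := one_add_pos_and_one_sub_pos_of_abs_lt hg (by norm_num)
  rw [abs_lt] at hg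
  rw [leafWeight]
  refine mul_le_mul_of_nonneg_right ?_ hβ
  rcases hsg v with h | h <;> rw [h]
  · have : u * ((1 + 1) / (1 + plSign m τ sg q)) + (1 - u) *
        ((1 - 1) / (1 - plSign m τ sg q)) = 2 * u / (1 + plSign m τ sg q) := by ring
    rw [this, div_le_iff₀ hp]
    linarith
  · have : u * ((1 + -1) / (1 + plSign m τ sg q)) + (1 - u) *
        ((1 - -1) / (1 - plSign m τ sg q)) = 2 * (1 - u) / (1 - plSign m τ sg q) := by ring
    rw [this, div_le_iff₀ hn]
    linarith

lemma leafPoint_mem_interior (hm : 0 < m) (hτ : IsLatticeTriangulation m τ)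
    (hsg : ∀ v, sg v = 1 ∨ sg v = -1) (hq : q ∈ interior (bigTriangle m))
    (hg : |plSign m τ sg q| < 1) {u : ℝ} (hu : 1 / 4 ≤ u) (hu' : u ≤ 3 / 4) :
    leafPoint m τ sg q u ∈ interior (bigTriangle m) := by
  obtain ⟨T, hT, hqT⟩ := exists_triangle_of_mem_interior hm hτ hq
  have hβ := isBarycentric_bary_interior hm hτ hq
  rw [mem_interior_iff_exists_deepPart hm] at hq ⊢
  obtain ⟨δ, hδ, hqδ⟩ := hq
  exact ⟨δ / 4, by positivity, deepPart_of_le_mul hm (vertexPoints_subset hm hτ) hβ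
    ((isBarycentric_leafPoint hm hτ hsg hT hqT hg (by linarith) (by linarith)).mono
      (face_subset_vertexPoints hm hτ hT.1)) (by norm_num)
    (fun v _ => le_leafWeight hsg (hβ.nonneg v) hg hu hu') hqδ⟩

lemma straighten_mem_interior (hm : 0 < m) (hτ : IsLatticeTriangulation m τ)
    (hsg : ∀ v, sg v = 1 ∨ sg v = -1) (hE : IsSmallPerturbation m τ E)
    (hq : q ∈ interior (bigTriangle m)) :
    straighten m τ sg E q ∈ interior (bigTriangle m) := by
  rw [straighten]
  split_ifs with h
  · obtain ⟨h1, h2⟩ := half_one_add_mem_of_abs_lt ((abs_perturbedSign_lt_iff hE hq).2 h)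
    exact leafPoint_mem_interior hm hτ hsg hq (h.trans (by norm_num)) (by linarith) (by linarith)
  · exact hq

lemma mem_deepPart_of_straighten_mem (hm : 0 < m) (hτ : IsLatticeTriangulation m τ)
    (hsg : ∀ v, sg v = 1 ∨ sg v = -1) (hE : IsSmallPerturbation m τ E)
    (hq : q ∈ interior (bigTriangle m)) {δ : ℝ} (hδ : 0 < δ)
    (h : straighten m τ sg E q ∈ deepPart m δ) : q ∈ deepPart m (δ / 4) := by
  rw [straighten] at h
  split_ifs at h with hg
  · obtain ⟨T, hT, hqT⟩ := exists_triangle_of_mem_interior hm hτ hq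
    obtain ⟨h1, h2⟩ := half_one_add_mem_of_abs_lt ((abs_perturbedSign_lt_iff hE hq).2 hg)
    have hβ := isBarycentric_bary_interior hm hτ hq
    exact deepPart_of_le_mul hm (vertexPoints_subset hm hτ)
      ((isBarycentric_leafPoint hm hτ hsg hT hqT (hg.trans (by norm_num)) (by linarith)
        (by linarith)).mono (face_subset_vertexPoints hm hτ hT.1)) hβ (by norm_num)
      (fun v _ => leafWeight_le hsg (hβ.nonneg v) hg (by linarith) (by linarith)) h
  · obtain ⟨h1, h2, h3⟩ := h
    exact ⟨by linarith, by linarith, by linarith⟩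

lemma plSign_straighten (hm : 0 < m) (hτ : IsLatticeTriangulation m τ)
    (hsg : ∀ v, sg v = 1 ∨ sg v = -1) (hE : IsSmallPerturbation m τ E)
    (hq : q ∈ interior (bigTriangle m)) :
    plSign m τ sg (straighten m τ sg E q) = perturbedSign m τ sg E q := by
  obtain ⟨T, hT, hqT⟩ := exists_triangle_of_mem_interior hm hτ hq
  rw [straighten]
  split_ifs with h
  · obtain ⟨h1, h2⟩ := half_one_add_mem_of_abs_lt ((abs_perturbedSign_lt_iff hE hq).2 h)
    rw [plSign_leafPoint hm hτ hsg hT hqT (h.trans (by norm_num)) (by linarith) (by linarith)]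
    ring
  · rw [perturbedSign_eq (by linarith)]

lemma continuousOn_straighten (hm : 0 < m) (hτ : IsLatticeTriangulation m τ)
    (hE : IsSmallPerturbation m τ E) :
    ContinuousOn (straighten m τ sg E) (interior (bigTriangle m)) := by
  have hg := continuousOn_plSign (sg := sg) hm hτ
  have hG := continuousOn_perturbedSign (sg := sg) hm hτ hE
  intro q hq
  have hqn := isOpen_interior.mem_nhds hq
  have hgq := (hg.continuousAt hqn)
  have hGq := (hG.continuousAt hqn)
  refine ContinuousAt.continuousWithinAt ?_
  by_cases h : |plSign m τ sg q| < 2 / 5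
  · obtain ⟨hp, hn⟩ := one_add_pos_and_one_sub_pos_of_abs_lt h (by norm_num)
    have hc : ContinuousAt
        (fun q => leafPoint m τ sg q ((1 + perturbedSign m τ sg E q) / 2)) q := by
      unfold leafPoint leafWeight
      refine tendsto_finsetSum _ fun v _ => ?_
      have hb : ContinuousAt (fun q => bary τ q v) q := (continuousOn_bary hm hτ v).continuousAt hqn
      have hu : ContinuousAt (fun q => (1 + perturbedSign m τ sg E q) / 2) q :=
        (continuousAt_const.add hGq).div_const _
      exact (((hu.mul (continuousAt_const.div (continuousAt_const.add hgq) hp.ne')).add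
        ((continuousAt_const.sub hu).mul
          (continuousAt_const.div (continuousAt_const.sub hgq) hn.ne'))).mul hb).smul
        continuousAt_const
    refine hc.congr ?_
    filter_upwards [hgq.abs.eventually_lt continuousAt_const h] with p hp
    rw [straighten, if_pos hp]
  · push Not at h
    have h' : 1 / 5 < |plSign m τ sg q| := by linarith
    refine continuousAt_id.congr ?_
    filter_upwards [continuousAt_const.eventually_lt hgq.abs h', hqn] with p hp hpm
    exact (straighten_of_le hp.le hm hτ hpm).symm

/-- Per unit of u the interpolated sign grows by 2. The variation of E costs at most 1/6, and that
of the cutoff at most 20 · (1/20) = 1, so the growth stays positive. -/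
lemma perturbedSign_leafPoint_strictMonoOn (hm : 0 < m) (hτ : IsLatticeTriangulation m τ)
    (hsg : ∀ v, sg v = 1 ∨ sg v = -1) (hE : IsSmallPerturbation m τ E)
    (hq : q ∈ interior (bigTriangle m)) (hg : |plSign m τ sg q| < 1) :
    StrictMonoOn (fun u => perturbedSign m τ sg E (leafPoint m τ sg q u))
      (Set.Icc (3 / 10) (7 / 10)) := by
  obtain ⟨T, hT, hqT⟩ := exists_triangle_of_mem_interior hm hτ hq
  rintro u ⟨hu, hu7⟩ u' ⟨hu3, hu'⟩ huu'
  have hmem : ∀ s, 3 / 10 ≤ s → s ≤ 7 / 10 →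
      leafPoint m τ sg q s ∈ interior (bigTriangle m) ∧
      leafPoint m τ sg q s ∈ convexHull ℝ (T : Set (ℝ × ℝ)) := fun s hs hs' =>
    ⟨leafPoint_mem_interior hm hτ hsg hq hg (by linarith) (by linarith),
      (isBarycentric_leafPoint hm hτ hsg hT hqT hg (by linarith) (by linarith)).mem_convexHull⟩
  have hmem' : ∀ x, (x = leafPoint m τ sg q u ∨ x = leafPoint m τ sg q u') →
      x ∈ interior (bigTriangle m) ∧ x ∈ convexHull ℝ (T : Set (ℝ × ℝ)) := by
    rintro x (rfl | rfl)
    exacts [hmem u hu hu7, hmem u' hu3 hu']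
  have h1 := abs_sub_leafPoint_le hm hτ hsg (E := E) hT hqT hg hu huu'.le hu'
    fun x y hx hy a ha ρ => hE.abs_sub_le T hT x (hmem' x hx).1 y (hmem' y hy).1 (hmem' x hx).2
      (hmem' y hy).2 a ha ρ
  have h2 := hE.abs_le _ (hmem u hu hu7).1
  have h3 := abs_cutoff_sub_le (2 * u' - 1) (2 * u - 1)
  have e3 : 2 * u' - 1 - (2 * u - 1) = 2 * (u' - u) := by ring
  rw [e3, abs_of_pos (by linarith : 0 < 2 * (u' - u))] at h3
  simp only [perturbedSign]
  rw [plSign_leafPoint hm hτ hsg hT hqT hg (by linarith) (by linarith),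
    plSign_leafPoint hm hτ hsg hT hqT hg (by linarith) (by linarith)]
  set E1 := E (leafPoint m τ sg q u)
  set E2 := E (leafPoint m τ sg q u')
  have k1 : |cutoff (2 * u' - 1) * (E2 - E1)| ≤ (u' - u) / 6 := by
    rw [abs_mul, abs_of_nonneg (cutoff_nonneg _)]
    exact (mul_le_of_le_one_left (abs_nonneg _) (cutoff_le_one _)).trans h1
  have k2 : |(cutoff (2 * u' - 1) - cutoff (2 * u - 1)) * E1| ≤ 20 * (u' - u) * (1 / 20) := by
    rw [abs_mul]
    exact mul_le_mul (by linarith) h2 (abs_nonneg _) (by linarith)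
  have k3 := (abs_le.1 k1).1
  have k4 := (abs_le.1 k2).1
  nlinarith

/-- Points with the same image lie on the leaf through that image and have the same perturbed sign,
which is strictly monotone along the leaf. -/
lemma straighten_injOn (hm : 0 < m) (hτ : IsLatticeTriangulation m τ)
    (hsg : ∀ v, sg v = 1 ∨ sg v = -1) (hE : IsSmallPerturbation m τ E) :
    Set.InjOn (straighten m τ sg E) (interior (bigTriangle m)) := by
  intro q hq q' hq' h
  have hG : perturbedSign m τ sg E q = perturbedSign m τ sg E q' := by
    rw [← plSign_straighten hm hτ hsg hE hq, ← plSign_straighten hm hτ hsg hE hq', h]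
  have hiff : |plSign m τ sg q| < 2 / 5 ↔ |plSign m τ sg q'| < 2 / 5 := by
    rw [← abs_perturbedSign_lt_iff hE hq, ← abs_perturbedSign_lt_iff hE hq', hG]
  by_cases hg : |plSign m τ sg q| < 2 / 5
  · have key : ∀ p ∈ interior (bigTriangle m), |plSign m τ sg p| < 2 / 5 →
        leafPoint m τ sg (straighten m τ sg E p) ((1 + plSign m τ sg p) / 2) = p := by
      intro p hp hgp
      obtain ⟨T, hT, hpT⟩ := exists_triangle_of_mem_interior hm hτ hp
      have h1 : |plSign m τ sg p| < 1 := hgp.trans (by norm_num)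
      obtain ⟨h2, h3⟩ := half_one_add_mem_of_abs_lt ((abs_perturbedSign_lt_iff hE hp).2 hgp)
      rw [straighten, if_pos hgp, leafPoint_leafPoint hm hτ hsg hT hpT h1 (by linarith)
        (by linarith), leafPoint_self hm hτ hT hpT h1]
    have k1 := key q hq hg
    have k2 := key q' hq' (hiff.1 hg)
    rw [← h] at k2
    obtain ⟨a1, a2⟩ := half_one_add_mem_of_abs_lt hg
    obtain ⟨b1, b2⟩ := half_one_add_mem_of_abs_lt (hiff.1 hg)
    have hy1 : |plSign m τ sg (straighten m τ sg E q)| < 1 := by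
      rw [plSign_straighten hm hτ hsg hE hq]
      exact ((abs_perturbedSign_lt_iff hE hq).2 hg).trans (by norm_num)
    have hinj := (perturbedSign_leafPoint_strictMonoOn hm hτ hsg hE
      (straighten_mem_interior hm hτ hsg hE hq) hy1).injOn ⟨a1.le, a2.le⟩ ⟨b1.le, b2.le⟩
      (by simp only [k1, k2, hG])
    rw [← k1, hinj, k2]
  · rwa [straighten, if_neg hg, straighten, if_neg (hiff.not.1 hg)] at h

/-- The intermediate value theorem on the leaf through y. At the parameters 3/10 and 7/10 the cutoff
vanishes, so the perturbed sign takes the values -2/5 and 2/5. -/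
lemma straighten_surjOn (hm : 0 < m) (hτ : IsLatticeTriangulation m τ)
    (hsg : ∀ v, sg v = 1 ∨ sg v = -1) (hE : IsSmallPerturbation m τ E) :
    Set.SurjOn (straighten m τ sg E) (interior (bigTriangle m)) (interior (bigTriangle m)) := by
  intro y hy
  by_cases hg : |plSign m τ sg y| < 2 / 5
  · obtain ⟨T, hT, hyT⟩ := exists_triangle_of_mem_interior hm hτ hy
    have hg1 : |plSign m τ sg y| < 1 := hg.trans (by norm_num)
    have hmem : ∀ u ∈ Set.Icc (3 / 10 : ℝ) (7 / 10),
        leafPoint m τ sg y u ∈ interior (bigTriangle m) := fun u hu =>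
      leafPoint_mem_interior hm hτ hsg hy hg1 (by linarith [hu.1]) (by linarith [hu.2])
    have hs : ∀ u ∈ Set.Icc (3 / 10 : ℝ) (7 / 10),
        plSign m τ sg (leafPoint m τ sg y u) = 2 * u - 1 := fun u hu =>
      plSign_leafPoint hm hτ hsg hT hyT hg1 (by linarith [hu.1]) (by linarith [hu.2])
    have hcl : Continuous fun u => leafPoint m τ sg y u := by
      have : (fun u => leafPoint m τ sg y u) = fun u =>
          u • leafPoint m τ sg y 1 + (1 - u) • leafPoint m τ sg y 0 := funext leafPoint_eq
      rw [this]
      fun_prop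
    have hcont : ContinuousOn (fun u => perturbedSign m τ sg E (leafPoint m τ sg y u))
        (Set.Icc (3 / 10) (7 / 10)) :=
      (continuousOn_perturbedSign hm hτ hE).comp hcl.continuousOn hmem
    have hend : ∀ u ∈ Set.Icc (3 / 10 : ℝ) (7 / 10), 1 / 5 ≤ |2 * u - 1| →
        perturbedSign m τ sg E (leafPoint m τ sg y u) = 2 * u - 1 := fun u hu h => by
      rw [perturbedSign_eq (by rwa [hs u hu]), hs u hu]
    have hl := hend (3 / 10) (by norm_num) (by norm_num [abs_of_neg])
    have hr := hend (7 / 10) (by norm_num) (by norm_num)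
    have hivt := intermediate_value_Ioo (by norm_num) hcont
    obtain ⟨u, hu, hGu⟩ := hivt (show plSign m τ sg y ∈ _ by
      rw [abs_lt] at hg
      simp only [hl, hr]
      constructor <;> linarith)
    have hu' := Set.Ioo_subset_Icc_self hu
    refine ⟨leafPoint m τ sg y u, hmem u hu', ?_⟩
    have hGu : perturbedSign m τ sg E (leafPoint m τ sg y u) = plSign m τ sg y := hGu
    rw [straighten, if_pos, hGu, leafPoint_leafPoint hm hτ hsg hT hyT hg1 (by linarith [hu.1])
      (by linarith [hu.2]), leafPoint_self hm hτ hT hyT hg1]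
    rw [hs u hu', abs_lt]
    constructor <;> linarith [hu.1, hu.2]
  · exact ⟨y, hy, straighten_of_le (by linarith) hm hτ hy⟩

end Straighten

/-! ### The expected sign as a perturbation on the interior of the triangle -/

/-- The deviation of the expected sign, read off through the moment map, from the piecewise linear
sign. -/
def signDeviation (m : ℕ) (τ : Geometry.SimplicialComplex ℝ (ℝ × ℝ)) (c sg : ℝ × ℝ → ℝ)
    (q : ℝ × ℝ) : ℝ :=
  gibbsSign (vertexPoints m τ) c sg (Function.invFun (momentMap (vertexPoints m τ) c) q) -
    plSign m τ sg q

section Deviation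

variable {m : ℕ} {τ : Geometry.SimplicialComplex ℝ (ℝ × ℝ)} {ν sg c : ℝ × ℝ → ℝ}

lemma continuous_gibbsSign {V : Finset (ℝ × ℝ)} (hV : V.Nonempty) :
    Continuous (gibbsSign V c sg) :=
  continuous_finsetSum _ fun v _ => continuous_const.mul (continuous_gibbs hV v)

lemma signDeviation_momentMap (hm : 0 < m) (hτ : IsLatticeTriangulation m τ) (w : ℝ × ℝ) :
    signDeviation m τ c sg (momentMap (vertexPoints m τ) c w) =
      gibbsSign (vertexPoints m τ) c sg w -
        plSign m τ sg (momentMap (vertexPoints m τ) c w) := by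
  rw [signDeviation, Function.leftInverse_invFun
    (momentMap_injective hm (convexHull_vertexPoints hm hτ).ge)]

lemma continuousOn_signDeviation (hm : 0 < m) (hτ : IsLatticeTriangulation m τ) :
    ContinuousOn (signDeviation m τ c sg) (interior (bigTriangle m)) := by
  have hV := convexHull_vertexPoints hm hτ
  have hne := nonempty_of_bigTriangle_subset hV.ge
  obtain ⟨φ, hφ⟩ := exists_homeomorph_momentMap (c := c) hm hV
  refine ContinuousOn.sub ?_ (continuousOn_plSign hm hτ)
  refine (continuous_gibbsSign hne).comp_continuousOn ?_
  rw [continuousOn_iff_continuous_domRestrict]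
  refine φ.symm.continuous.congr fun q => ?_
  obtain ⟨w, rfl⟩ := φ.surjective q
  rw [Set.domRestrict_apply, hφ, φ.symm_apply_apply,
    Function.leftInverse_invFun (momentMap_injective hm hV.ge)]

lemma eventually_isSmallPerturbation (hm : 0 < m) (hτ : IsLatticeTriangulation m τ)
    (hν : CertifiesConvexity m τ ν) (hsg : ∀ v, sg v = 1 ∨ sg v = -1) :
    ∀ᶠ N in atTop, IsSmallPerturbation m τ (signDeviation m τ (scaledWeight ν N) sg) := by
  have hV := convexHull_vertexPoints hm hτ
  have hsg' : ∀ v, |sg v| ≤ 1 := fun v => by rcases hsg v with h | h <;> rw [h] <;> norm_num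
  have := (eventually_all_finite (finite_triangles hm hτ)).2 fun T hT =>
    eventually_abs_gibbsSign_sub_le hm hτ hν hsg' hT
  filter_upwards [this] with N hN
  refine ⟨continuousOn_signDeviation hm hτ, fun q hq => ?_,
    fun T hT x hx y hy hxT hyT a ha ρ hρ hρ' hxa hxy => ?_⟩
  · obtain ⟨T, hT, hqT⟩ := exists_triangle_of_mem_interior hm hτ hq
    obtain ⟨w, rfl⟩ := exists_momentMap_eq (c := scaledWeight ν N) hm hV.ge hq
    rw [signDeviation_momentMap hm hτ]
    exact (hN T hT w hqT).1
  · obtain ⟨w, rfl⟩ := exists_momentMap_eq (c := scaledWeight ν N) hm hV.ge hx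
    obtain ⟨w', rfl⟩ := exists_momentMap_eq (c := scaledWeight ν N) hm hV.ge hy
    rw [signDeviation_momentMap hm hτ, signDeviation_momentMap hm hτ]
    exact (hN T hT w hxT).2 w' hyT a ha ρ hρ hρ' hxa hxy

/-- If the expected sign is a small perturbation of the piecewise linear sign, then the plane is
homeomorphic to the interior of the triangle, by a homeomorphism that matches the zero sets. -/
lemma exists_homeomorph_gibbsSign_eq_zero_iff (hm : 0 < m) (hτ : IsLatticeTriangulation m τ)
    (hsg : ∀ v, sg v = 1 ∨ sg v = -1)
    (hE : IsSmallPerturbation m τ (signDeviation m τ c sg)) :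
    ∃ φ : ℝ × ℝ ≃ₜ interior (bigTriangle m), ∀ w,
      gibbsSign (vertexPoints m τ) c sg w = 0 ↔ plSign m τ sg (φ w) = 0 := by
  have hV := convexHull_vertexPoints hm hτ
  have hint := momentMap_mem_interior (c := c) hm hV
  -- The homeomorphism is the moment map followed by straightening; both are proper in terms of
  -- depth.
  obtain ⟨φ, hφ⟩ := exists_homeomorph_of_proper hm
    (f := fun w => straighten m τ sg (signDeviation m τ c sg) (momentMap (vertexPoints m τ) c w))
    ((continuousOn_straighten hm hτ hE).comp_continuous
      (continuous_momentMap (nonempty_of_bigTriangle_subset hV.ge)) hint)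
    (fun w w' h => momentMap_injective hm hV.ge
      (straighten_injOn hm hτ hsg hE (hint w) (hint w') h))
    (by
      apply Set.Subset.antisymm
      · rintro _ ⟨w, rfl⟩
        exact straighten_mem_interior hm hτ hsg hE (hint w)
      · intro y hy
        obtain ⟨q, hq, rfl⟩ := straighten_surjOn hm hτ hsg hE hy
        obtain ⟨w, rfl⟩ := exists_momentMap_eq (c := c) hm hV.ge hq
        exact ⟨w, rfl⟩)
    (fun δ hδ => by
      obtain ⟨R, hR⟩ := norm_le_of_momentMap_mem_deepPart (c := c) hm hV.ge
        (show 0 < δ / 4 by positivity)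
      exact ⟨R, fun w hw =>
        hR w (mem_deepPart_of_straighten_mem hm hτ hsg hE (hint w) hδ hw)⟩)
  refine ⟨φ, fun w => ?_⟩
  rw [hφ, plSign_straighten hm hτ hsg hE (hint w), perturbedSign_eq_zero_iff hE (hint w),
    signDeviation_momentMap hm hτ, add_sub_cancel]

end Deviation

/-! ### The polynomial and the piecewise linear curve -/

/-- The sign of a lattice point of the plane. -/
def signAt (σ : ℕ × ℕ → ℤˣ) (v : ℝ × ℝ) : ℝ := ((σ (⌊v.1⌋₊, ⌊v.2⌋₊) : ℤ) : ℝ)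

lemma signAt_latticePoint (σ : ℕ × ℕ → ℤˣ) (p : ℕ × ℕ) :
    signAt σ (latticePoint p) = ((σ p : ℤ) : ℝ) := by
  simp [signAt, latticePoint]

lemma signAt_eq_one_or (σ : ℕ × ℕ → ℤˣ) (v : ℝ × ℝ) : signAt σ v = 1 ∨ signAt σ v = -1 := by
  rw [signAt]
  rcases Int.units_eq_one_or (σ (⌊v.1⌋₊, ⌊v.2⌋₊)) with h | h <;> rw [h] <;> simp

lemma eval_patchPoly_eq_zero_iff {m : ℕ} (hm : 0 < m)
    {τ : Geometry.SimplicialComplex ℝ (ℝ × ℝ)} (hτ : IsLatticeTriangulation m τ)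
    (σ : ℕ × ℕ → ℤˣ) (ν : ℝ × ℝ → ℝ) {t : ℝ} (ht : 0 < t) (w : ℝ × ℝ) :
    MvPolynomial.eval ![Real.exp w.1, Real.exp w.2] (patchPoly m τ σ ν t) = 0 ↔
      gibbsSign (vertexPoints m τ) (scaledWeight ν (-Real.log t)) (signAt σ) w = 0 := by
  have hne := nonempty_of_bigTriangle_subset (convexHull_vertexPoints hm hτ).ge
  have hZ := partitionFn_pos (c := scaledWeight ν (-Real.log t)) hne w
  have h : MvPolynomial.eval ![Real.exp w.1, Real.exp w.2] (patchPoly m τ σ ν t) =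
      partitionFn (vertexPoints m τ) (scaledWeight ν (-Real.log t)) w *
        gibbsSign (vertexPoints m τ) (scaledWeight ν (-Real.log t)) (signAt σ) w := by
    rw [gibbsSign, Finset.mul_sum]
    conv_rhs => rw [vertexPoints, Finset.sum_image fun _ _ _ _ h => latticePoint_injective h]
    rw [patchPoly, map_sum]
    refine Finset.sum_congr rfl fun p _ => ?_
    rw [signAt_latticePoint, gibbs, ← vertexPoints]
    have e : Real.exp (dot (latticePoint p) w + scaledWeight ν (-Real.log t) (latticePoint p)) =
        t ^ ν (latticePoint p) * Real.exp w.1 ^ p.1 * Real.exp w.2 ^ p.2 := by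
      rw [Real.rpow_def_of_pos ht, ← Real.exp_nat_mul, ← Real.exp_nat_mul, ← Real.exp_add,
        ← Real.exp_add]
      congr 1
      simp only [dot, latticePoint, scaledWeight]
      ring
    rw [e]
    simp
    field_simp
  rw [h, mul_eq_zero, or_iff_right hZ.ne']

/-- In a triangle with lone vertex a the interpolated sign is ±(2β - 1), β being the coordinate of
a. It vanishes exactly at β = 1/2, which is the midline. -/
lemma mem_plCurve_iff {m : ℕ} (hm : 0 < m) {τ : Geometry.SimplicialComplex ℝ (ℝ × ℝ)}
    (hτ : IsLatticeTriangulation m τ) (σ : ℕ × ℕ → ℤˣ) {q : ℝ × ℝ}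
    (hq : q ∈ interior (bigTriangle m)) : q ∈ plCurve τ σ ↔ plSign m τ (signAt σ) q = 0 := by
  classical
  have hne : ∀ a b, σ a ≠ σ b ↔ signAt σ (latticePoint b) = - signAt σ (latticePoint a) := by
    intro a b
    rw [signAt_latticePoint, signAt_latticePoint]
    rcases Int.units_eq_one_or (σ a) with h | h <;> rcases Int.units_eq_one_or (σ b) with h' | h' <;>
      rw [h, h'] <;> norm_num
  constructor
  · rintro ⟨a, b, c, hT, hab, hac, hseg⟩
    rw [hne] at hab hac
    have hT' : ({latticePoint a, latticePoint b, latticePoint c} : Finset (ℝ × ℝ)) ∈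
      triangles τ := by convert hT
    have hne0 : signAt σ (latticePoint a) ≠ - signAt σ (latticePoint a) := by
      rcases signAt_eq_one_or σ (latticePoint a) with h | h <;> rw [h] <;> norm_num
    have hba : latticePoint b ≠ latticePoint a := fun h => by rw [h] at hab; exact hne0 hab
    have hca : latticePoint c ≠ latticePoint a := fun h => by rw [h] at hac; exact hne0 hac
    have hcb : latticePoint c ≠ latticePoint b := fun h => by
      have h3 := hT'.2
      rw [h, Finset.pair_eq_singleton, Finset.card_pair hba.symm] at h3
      omega
    obtain ⟨r, s, hr, hs, hrs, rfl⟩ := hseg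
    let w : ℝ × ℝ → ℝ := fun v => if v = latticePoint a then 1 / 2 else
      if v = latticePoint b then r / 2 else if v = latticePoint c then s / 2 else 0
    have wa : w (latticePoint a) = 1 / 2 := by simp [w]
    have wb : w (latticePoint b) = r / 2 := by simp [w, hba]
    have wc : w (latticePoint c) = s / 2 := by simp [w, hca, hcb]
    have hw : IsBarycentric {latticePoint a, latticePoint b, latticePoint c}
        (r • midpoint ℝ (latticePoint a) (latticePoint b) +
          s • midpoint ℝ (latticePoint a) (latticePoint c)) w := by
      refine ⟨fun v => ?_, fun v hv => ?_, ?_, ?_⟩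
      · simp only [w]
        split_ifs <;> positivity
      · simp only [Finset.mem_insert, Finset.mem_singleton, not_or] at hv
        simp only [w]
        rw [if_neg hv.1, if_neg hv.2.1, if_neg hv.2.2]
      · rw [Finset.sum_insert (by simp [hba.symm, hca.symm]), Finset.sum_pair hcb.symm, wa, wb, wc]
        linarith
      · rw [Finset.sum_insert (by simp [hba.symm, hca.symm]), Finset.sum_pair hcb.symm, wa, wb, wc]
        have : r = 1 - s := by linarith
        subst this
        simp only [midpoint_eq_smul_add, invOf_eq_inv]
        module
    rw [plSign_eq_of_lone hm hτ hT' hw (a := latticePoint a) (by simp) (fun v hv hva => ?_), wa]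
    · norm_num
    · simp only [Finset.mem_insert, Finset.mem_singleton] at hv
      rcases hv with rfl | rfl | rfl
      exacts [absurd rfl hva, hab, hac]
  · intro h
    obtain ⟨T, hT, hqT⟩ := exists_triangle_of_mem_interior hm hτ hq
    obtain ⟨a, ha, hlone⟩ := exists_lone_vertex hm hτ (signAt_eq_one_or σ) hT hqT (by
      rw [h, abs_zero]; exact one_pos)
    have hβ := isBarycentric_bary hT.1 hqT
    have hwa : bary τ q a = 1 / 2 := by
      rw [plSign_eq_of_lone hm hτ hT hβ ha hlone] at h
      rcases signAt_eq_one_or σ a with h' | h' <;> rw [h'] at h <;> linarith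
    have hcard : (T.erase a).card = 2 := by rw [Finset.card_erase_of_mem ha, hT.2]
    obtain ⟨b, c, hbc, hTe⟩ := Finset.card_eq_two.1 hcard
    have hTeq : T = {a, b, c} := by rw [← Finset.insert_erase ha, hTe]
    have hb : b ∈ T.erase a := by simp [hTe]
    have hc : c ∈ T.erase a := by simp [hTe]
    rw [Finset.mem_erase] at hb hc
    have hlat : ∀ v ∈ T, ∃ p, latticePoint p = v := fun v hv => by
      obtain ⟨p, -, hp⟩ := Finset.mem_image.1 (face_subset_vertexPoints hm hτ hT.1 hv)
      exact ⟨p, hp⟩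
    have hsum := hβ.sum_eq_one
    have hsmul := hβ.sum_smul
    rw [← Finset.add_sum_erase _ _ ha, hTe, Finset.sum_pair hbc, hwa] at hsum hsmul
    have hlb := hlone b hb.2 hb.1
    have hlc := hlone c hc.2 hc.1
    have h0b := hβ.nonneg b
    have h0c := hβ.nonneg c
    obtain ⟨pa, rfl⟩ := hlat a ha
    obtain ⟨pb, rfl⟩ := hlat b hb.2
    obtain ⟨pc, rfl⟩ := hlat c hc.2
    refine ⟨pa, pb, pc, ?_, (hne _ _).2 hlb, (hne _ _).2 hlc, ?_⟩
    · rw [hTeq] at hT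
      convert hT
    -- The lone vertex has coordinate 1/2, so the doubled coordinates of the other two sum to 1 and
    -- are the position on the midline.
    · refine ⟨2 * bary τ q (latticePoint pb), 2 * bary τ q (latticePoint pc), by positivity,
        by positivity, by linarith, ?_⟩
      generalize bary τ q (latticePoint pb) = r at *
      generalize bary τ q (latticePoint pc) = s at *
      have : r = 1 / 2 - s := by linarith
      subst this
      rw [← hsmul]
      simp only [midpoint_eq_smul_add, invOf_eq_inv]
      module

/-- The coordinatewise logarithm. -/
def logHomeomorph : openQuadrant ≃ₜ ℝ × ℝ where
  toFun q := (Real.log q.1.1, Real.log q.1.2)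
  invFun w := ⟨(Real.exp w.1, Real.exp w.2), Real.exp_pos _, Real.exp_pos _⟩
  left_inv q := Subtype.ext (Prod.ext (Real.exp_log q.2.1) (Real.exp_log q.2.2))
  right_inv w := Prod.ext (Real.log_exp _) (Real.log_exp _)
  continuous_toFun := by
    have h1 : ∀ q : openQuadrant, q.1.1 ≠ 0 := fun q => q.2.1.ne'
    have h2 : ∀ q : openQuadrant, q.1.2 ≠ 0 := fun q => q.2.2.ne'
    fun_prop (disch := assumption)
  continuous_invFun := by fun_prop

end Patchwork

end

theorem mainTheorem1 (m : ℕ) (hm : 0 < m)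
    (τ : Geometry.SimplicialComplex ℝ (ℝ × ℝ)) (hτ : Patchwork.IsLatticeTriangulation m τ)
    (σ : ℕ × ℕ → ℤˣ)
    (ν : ℝ × ℝ → ℝ) (hν : Patchwork.CertifiesConvexity m τ ν) :
    ∀ᶠ t in 𝓝[>] (0 : ℝ),
      Patchwork.PairHomeomorphic
        Patchwork.openQuadrant
        (Patchwork.curveInQuadrant (Patchwork.patchPoly m τ σ ν t))
        (interior (Patchwork.bigTriangle m))
        (Patchwork.plCurve τ σ ∩ interior (Patchwork.bigTriangle m)) := by
  have hlog : Tendsto (fun t : ℝ => -Real.log t) (𝓝[>] 0) atTop :=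
    tendsto_neg_atBot_atTop.comp Real.tendsto_log_nhdsGT_zero
  filter_upwards [hlog.eventually (Patchwork.eventually_isSmallPerturbation hm hτ hν
    (Patchwork.signAt_eq_one_or σ)), self_mem_nhdsWithin] with t hE ht
  obtain ⟨φ, hφ⟩ := Patchwork.exists_homeomorph_gibbsSign_eq_zero_iff hm hτ
    (Patchwork.signAt_eq_one_or σ) hE
  refine ⟨Patchwork.logHomeomorph.trans φ, ?_⟩
  have key : ∀ q : Patchwork.openQuadrant,
      (q : ℝ × ℝ) ∈ Patchwork.curveInQuadrant (Patchwork.patchPoly m τ σ ν t) ↔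
      (φ (Patchwork.logHomeomorph q) : ℝ × ℝ) ∈ Patchwork.plCurve τ σ := by
    intro q
    obtain ⟨w, rfl⟩ := Patchwork.logHomeomorph.symm.surjective q
    rw [Homeomorph.apply_symm_apply, Patchwork.mem_plCurve_iff hm hτ σ (φ w).2, ← hφ,
      ← Patchwork.eval_patchPoly_eq_zero_iff hm hτ σ ν ht]
    exact and_iff_right (Patchwork.logHomeomorph.symm w).2
  ext y
  obtain ⟨q, rfl⟩ := (Patchwork.logHomeomorph.trans φ).surjective y
  rw [(Patchwork.logHomeomorph.trans φ).injective.mem_set_image]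
  simp only [Set.mem_preimage, Set.mem_inter_iff, Homeomorph.trans_apply]
  rw [key q]
  exact (and_iff_left (φ _).2).symm
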